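/- **Notation.** Let $0<q<1$. Put $(x;p)_n=\prod_{j=0}^{n-1}(1-xp^j)$ for $n\in\mathbb Z_{\ge0}\cup\{\infty\}$ and $\theta(x;p)=(x,p/x;p)_\infty$; a list of arguments means the product, and a sign $\pm1$ in an exponent means the product over both signs. For $\alpha=(s,u,t,v,\lambda,\varepsilon)$ with $\lambda,\varepsilon\in\mathbb R$ and $s,u,t,v\in\mathbb C^\times$ put $\bar\alpha=(\bar s,\bar u,\bar t,\bar v,\lambda,\varepsilon)$, $\alpha^\vartheta=(t,v,s,u,\lambda,-\varepsilon)$ and $$f_{x,\alpha}(z)=\frac{(sq^{1-2i\lambda}x^{\pm1},\,usz\,q^{1+i\lambda};q^2)_\infty\,\theta(q^{2\varepsilon-i\lambda}uz/s;q^2)}{(uzq^{-i\lambda}x^{\pm1},\,sq^{1-i\lambda}/uz;q^2)_\infty}.$$ Let $\langle f,g\rangle=\frac1{2\pi i}\int_{\mathbb T}f(z)\,g^\star(z)\frac{dz}z$, where $\mathbb T$ is the positively oriented unit circle and $g^\star(z)=\overline{g(1/\bar z)}$, and put $\bar f^{\vartheta}_{x}(z)=f_{x,\bar\alpha^\vartheta}(1/z)$.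 If $$0<|ux|,|u/x|,|vy|,|v/y|\le q^2,\qquad 0<|s/u|,|t/v|\le q, \tag{1}$$ the overlap coefficient is $\Phi(x,y)=\langle f_{x,\alpha},\bar f^{\vartheta}_{\bar y}\rangle$. Without condition (1), $\Phi(x,y)$ is defined by integrating the same integrand over a deformation $\mathcal C$ of $\mathbb T$: a closed (piecewise) $C^1$ curve in $\mathbb C^\times$ that avoids the points listed below, has winding number $1$ about $0$ and about the points $u^{-1}sq^{1-i\lambda}q^{2k}$, $v^{-1}tq^{1+i\lambda}q^{2k}$, and has winding number $0$ about the points $u^{-1}q^{i\lambda}x^{\pm1}q^{-2k}$, $v^{-1}q^{-i\lambda}y^{\pm1}q^{-2k}$ ($k\in\mathbb Z_{\ge0}$). For parameters $A,B,C,D$, a base $p$, and a choice of root $\widetilde A=\sqrt{ABCD/p}$, with $\widetilde D=AD/\widetilde A$, the Askey–Wilson function is $$\psi_\gamma(x;A,B,C,D|p)=\frac{(AB,AC;p)_\infty}{(p/AD;p)_\infty}\,{}_4\varphi_3\!\left[{Ax,\,A/x,\,\widetilde A\gamma,\,\widetilde A/\gamma\atop AB,\,AC,\,AD};p,p\right]+\frac{(Ax^{\pm1},\widetilde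 A\gamma^{\pm1},pB/D,pC/D;p)_\infty}{(px^{\pm1}/D,\,p\gamma^{\pm1}/\widetilde D,\,AD/p;p)_\infty}\,{}_4\varphi_3\!\left[{px/D,\,p/Dx,\,p\gamma/\widetilde D,\,p/\widetilde D\gamma\atop pB/D,\,pC/D,\,p^2/AD};p,p\right].$$ **Theorem.** Let $s,t,u,v\in\mathbb R^\times$, $\lambda,\varepsilon\in\mathbb R$, $x,y\in\mathbb C^\times$, and $$(a,b,c,d,\kappa)=\bigl(sq^{1-2i\lambda},\;sq^{1+2i\lambda},\;tvq/u,\;qv/ut,\;q^{-1-2\varepsilon+2i\lambda}\bigr),\qquad b^\vartheta=tq^{1+2i\lambda},\quad d^\vartheta=uq/vs.$$ Then $(q^2/d^\vartheta)^2=abcd/q^2$. Let $\psi_y(x;a,b,c,d|q^2)$ be taken with the root $\tilde a=q^2/d^\vartheta=svq/u$ of $abcd/q^2$, and assume $ad\notin q^{2\mathbb Z}$. Then $$\Phi(x,y)=\frac{(b^\vartheta y^{\pm1};q^2)_\infty\,\theta(1/\kappa,\,ad\kappa;q^2)}{(q^2,\,q^2y^{\pm1}/d^\vartheta;q^2)_\infty}\;\psi_y(x;a,b,c,d|q^2)$$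 in each of the following cases: (i) condition (1) holds and $\Phi(x,y)=\langle f_{x,\alpha},\bar f^\vartheta_{\bar y}\rangle$; (ii) none of $ab,\ ac,\ q^2b/d,\ q^2c/d$ lies in $q^{-2\mathbb Z_{\ge0}}$ and $\Phi(x,y)$ is the integral over any deformation $\mathcal C$ of $\mathbb T$ as above. -/

import Mathlib

noncomputable section

namespace AWOverlap

open Complex

/-- The finite `q`-shifted factorial `(x;p)_n = ∏_{j<n} (1 - x p^j)`. -/
def qPoch (p x : ℂ) (n : ℕ) : ℂ := ∏ j ∈ Finset.range n, (1 - x * p ^ j)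

/-- The infinite `q`-shifted factorial `(x;p)_∞ = ∏_{j≥0} (1 - x p^j)`, for `|p| < 1`. -/
def qPochInf (p x : ℂ) : ℂ := ∏' j : ℕ, (1 - x * p ^ j)

/-- The theta function `θ(x;p) = (x, p/x; p)_∞`. -/
def qTheta (p x : ℂ) : ℂ := qPochInf p x * qPochInf p (p / x)

/-- `(a x^{±1}; p)_∞ = (a x, a/x; p)_∞`. -/
def qPochPM (p a x : ℂ) : ℂ := qPochInf p (a * x) * qPochInf p (a / x)

/-- The basic hypergeometric series `₄φ₃(a₁,a₂,a₃,a₄; b₁,b₂,b₃; p, z)`. -/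
def phi43 (p a₁ a₂ a₃ a₄ b₁ b₂ b₃ z : ℂ) : ℂ :=
  ∑' n : ℕ, (qPoch p a₁ n * qPoch p a₂ n * qPoch p a₃ n * qPoch p a₄ n) /
    (qPoch p p n * qPoch p b₁ n * qPoch p b₂ n * qPoch p b₃ n) * z ^ n

/-- The Askey-Wilson function `ψ_g(x; A,B,C,D | p)`. Its definition involves a square root
`Ã = √(ABCD/p)`; the choice `At` of that root is an explicit argument, and `D̃ = AD/Ã`. -/
def askeyWilson (p At A B C D g x : ℂ) : ℂ :=
  qPochInf p (A * B) * qPochInf p (A * C) / qPochInf p (p / (A * D)) *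
      phi43 p (A * x) (A / x) (At * g) (At / g) (A * B) (A * C) (A * D) p
  + (qPochPM p A x * qPochPM p At g * qPochInf p (p * B / D) * qPochInf p (p * C / D)) /
      (qPochPM p (p / D) x * qPochPM p (p / (A * D / At)) g * qPochInf p (A * D / p)) *
      phi43 p (p * x / D) (p / (D * x)) (p * g / (A * D / At)) (p / ((A * D / At) * g))
        (p * B / D) (p * C / D) (p ^ 2 / (A * D)) p

/-- The 6-tuple `α = (s,u,t,v,λ,ε)`. -/
structure Params where
  s : ℂ
  u : ℂ
  t : ℂ
  v : ℂ
  lam : ℝ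
  eps : ℝ

/-- The involution `α ↦ α^ϑ = (t,v,s,u,λ,-ε)`. -/
def Params.theta (α : Params) : Params := ⟨α.t, α.v, α.s, α.u, α.lam, -α.eps⟩

/-- `ᾱ`, the complex conjugate of `α`. -/
def Params.bar (α : Params) : Params :=
  ⟨star α.s, star α.u, star α.t, star α.v, α.lam, α.eps⟩

/-- The eigenfunction `f_{x,α}(z)`. -/
def eigenfun (q : ℝ) (α : Params) (x z : ℂ) : ℂ :=
  (qPochPM (q ^ 2) (α.s * (q : ℂ) ^ (1 - 2 * I * α.lam)) x *
      qPochInf (q ^ 2) (α.u * α.s * z * (q : ℂ) ^ (1 + I * α.lam)) *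
      qTheta (q ^ 2) ((q : ℂ) ^ (2 * α.eps - I * α.lam) * α.u * z / α.s)) /
    (qPochPM (q ^ 2) (α.u * z * (q : ℂ) ^ (-I * α.lam)) x *
      qPochInf (q ^ 2) (α.s * (q : ℂ) ^ (1 - I * α.lam) / (α.u * z)))

/-- The reflection `(r f)(z) = f(1/z)`. -/
def reflect (f : ℂ → ℂ) (z : ℂ) : ℂ := f z⁻¹

/-- `g^⋆(z)`, the complex conjugate of `g(1 / z̄)`. -/
def starFun (g : ℂ → ℂ) (z : ℂ) : ℂ := star (g (star z)⁻¹)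

/-- The inner product `⟨f,g⟩ = (2πi)⁻¹ ∫_𝕋 f(z) g^⋆(z) dz/z`. -/
def innerT (f g : ℂ → ℂ) : ℂ :=
  (2 * Real.pi * I)⁻¹ * ∮ z in C(0, 1), f z * starFun g z / z

/-- The eigenfunction `f̄^ϑ_x = r f_{x, ᾱ^ϑ}` of the second twisted primitive element. -/
def eigenfunThetaBar (q : ℝ) (α : Params) (x : ℂ) : ℂ → ℂ :=
  reflect (eigenfun q α.bar.theta x)

/-- The overlap coefficient `Φ_α(x,y) = ⟨f_x, f̄^ϑ_ȳ⟩`. -/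
def overlap (q : ℝ) (α : Params) (x y : ℂ) : ℂ :=
  innerT (eigenfun q α x) (eigenfunThetaBar q α (star y))

/-- The conditions under which the overlap coefficient is defined as an integral over `𝕋`. -/
def OverlapCond (q : ℝ) (α : Params) (x y : ℂ) : Prop :=
  (0 < ‖α.u * x‖ ∧ ‖α.u * x‖ ≤ q ^ 2) ∧ (0 < ‖α.u / x‖ ∧ ‖α.u / x‖ ≤ q ^ 2) ∧
  (0 < ‖α.v * y‖ ∧ ‖α.v * y‖ ≤ q ^ 2) ∧ (0 < ‖α.v / y‖ ∧ ‖α.v / y‖ ≤ q ^ 2) ∧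
  (0 < ‖α.s / α.u‖ ∧ ‖α.s / α.u‖ ≤ q) ∧ (0 < ‖α.t / α.v‖ ∧ ‖α.t / α.v‖ ≤ q)

/-- `(2πi)⁻¹ ∫_γ F(z) dz` along the curve `γ : [0,1] → ℂ`. -/
def loopIntegral (γ : ℝ → ℂ) (F : ℂ → ℂ) : ℂ :=
  (2 * Real.pi * I)⁻¹ * ∫ τ in (0 : ℝ)..1, deriv γ τ * F (γ τ)

/-- The winding number of the closed curve `γ` about `w`. -/
def winding (γ : ℝ → ℂ) (w : ℂ) : ℂ := loopIntegral γ (fun z => (z - w)⁻¹)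

/-- The poles of the integrand of `Φ` accumulating at `0`. -/
def innerPoles (q : ℝ) (α : Params) : Set ℂ :=
  {p | ∃ k : ℕ, p = α.s * (q : ℂ) ^ (1 - I * α.lam) / α.u * (q : ℂ) ^ (2 * k) ∨
    p = α.t * (q : ℂ) ^ (1 + I * α.lam) / α.v * (q : ℂ) ^ (2 * k)}

/-- The poles of the integrand of `Φ` tending to infinity. -/
def outerPoles (q : ℝ) (α : Params) (x y : ℂ) : Set ℂ :=
  {p | ∃ k : ℕ, p = (q : ℂ) ^ (I * α.lam) * x / α.u / (q : ℂ) ^ (2 * k) ∨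
    p = (q : ℂ) ^ (I * α.lam) / (α.u * x) / (q : ℂ) ^ (2 * k) ∨
    p = (q : ℂ) ^ (-I * α.lam) * y / α.v / (q : ℂ) ^ (2 * k) ∨
    p = (q : ℂ) ^ (-I * α.lam) / (α.v * y) / (q : ℂ) ^ (2 * k)}

/-- `γ|[0,1]` is a closed `C¹` curve in `ℂ \ {0}` going once, in the positive direction, around
`0` and around every inner pole, and not going around any outer pole. The derivative of `γ` may
vanish, so that piecewise `C¹` curves are covered after reparametrization. -/
structure IsContour (q : ℝ) (α : Params) (x y : ℂ) (γ : ℝ → ℂ) : Prop where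
  contDiff : ContDiff ℝ 1 γ
  closed : γ 0 = γ 1
  ne_zero : ∀ τ ∈ Set.Icc (0 : ℝ) 1, γ τ ≠ 0
  winding_zero : winding γ 0 = 1
  inner_ne : ∀ p ∈ innerPoles q α, ∀ τ ∈ Set.Icc (0 : ℝ) 1, γ τ ≠ p
  winding_inner : ∀ p ∈ innerPoles q α, winding γ p = 1
  outer_ne : ∀ p ∈ outerPoles q α x y, ∀ τ ∈ Set.Icc (0 : ℝ) 1, γ τ ≠ p
  winding_outer : ∀ p ∈ outerPoles q α x y, winding γ p = 0

/-- The extended overlap coefficient: the integrand of `⟨f_x, f̄^ϑ_ȳ⟩`, integrated over the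
deformation `γ` of `𝕋`. -/
def overlapAlong (q : ℝ) (α : Params) (γ : ℝ → ℂ) (x y : ℂ) : ℂ :=
  loopIntegral γ (fun z => eigenfun q α x z * starFun (eigenfunThetaBar q α (star y)) z / z)

/-- `a = s q^{1-2iλ}`. -/
def parA (q : ℝ) (α : Params) : ℂ := α.s * (q : ℂ) ^ (1 - 2 * I * α.lam)

/-- `b = s q^{1+2iλ}`. -/
def parB (q : ℝ) (α : Params) : ℂ := α.s * (q : ℂ) ^ (1 + 2 * I * α.lam)

/-- `c = t v q / u`. -/
def parC (q : ℝ) (α : Params) : ℂ := α.t * α.v * q / α.u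

/-- `d = q v / (u t)`. -/
def parD (q : ℝ) (α : Params) : ℂ := q * α.v / (α.u * α.t)

/-- `κ = q^{-1-2ε+2iλ}`. -/
def parKappa (q : ℝ) (α : Params) : ℂ := (q : ℂ) ^ (-1 - 2 * α.eps + 2 * I * α.lam)

/-- The factor `(b^ϑ y^{±1};q²)_∞ θ(1/κ, adκ; q²) / (q², q² y^{±1}/d^ϑ; q²)_∞`. -/
def prefactor (q : ℝ) (α : Params) (y : ℂ) : ℂ :=
  (qPochPM (q ^ 2) (parB q α.theta) y *
      (qTheta (q ^ 2) (1 / parKappa q α) *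
        qTheta (q ^ 2) (parA q α * parD q α * parKappa q α))) /
    (qPochInf (q ^ 2) (q ^ 2) * qPochPM (q ^ 2) (q ^ 2 / parD q α.theta) y)

end AWOverlap

end

noncomputable section

namespace AWOverlap

open Complex Filter Topology

/-! ### The `q`-shifted factorials -/

/-! Put p = q². Collecting factors, the integrand is E(z) (μ/z, ν/z;p)_∞ / (σ/z, τ/z;p)_∞ · 1/z.
Here μ and ν come from the two theta functions, σ pᵏ and τ pᵏ are the poles accumulating at 0, and
all poles of E lie outside the contour. The parameters are balanced: μν = pστ. The integral should
be the sum of the residues at σ pᵏ and τ pᵏ. Each of the two residue series is a ₄φ₃, the symmetry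
of θ gives both the same theta factor, and their sum is the Askey–Wilson function.

The obstacle is that 0 is not an isolated singularity. The four products in 1/z are therefore cut
off after N factors, which leaves simple poles at 0, σ pᵏ, τ pᵏ with k < N
(`loopIntegral_truncated`); they are distinct because pσ/τ = ad is not a power of p. By the
balancing relation the residue at 0 is (μν/στ)^N E(0) = p^N E(0), which tends to 0. The same
relation puts a factor pᵏ into the k-th residue, so dominated convergence applies to the sums
(`tendsto_sum_residue`). The integrals converge as well, which gives `loopIntegral_eq_residueSum`.

The contour is known only through its winding numbers, so the residue theorem is derived from these.
On a ball containing the curve, E is a holomorphic function times finitely many factors (z - w)⁻¹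
with w of winding number 0 (`OuterMero`). Partial fractions and divided differences reduce each
integral to functions with a primitive and to winding integrals.

`residueSum_eq_phi43` identifies the series and `loopIntegral_mul_eigenfunAux` matches the
parameters. Under condition (1) the unit circle is itself an admissible contour and the genericity
conditions hold automatically, so case (i) is an instance of case (ii). -/

lemma qPoch_zero (p x : ℂ) : qPoch p x 0 = 1 := by simp [qPoch]

lemma qPoch_succ (p x : ℂ) (n : ℕ) : qPoch p x (n + 1) = qPoch p x n * (1 - x * p ^ n) :=
  Finset.prod_range_succ _ _

lemma qPoch_add (p x : ℂ) (m n : ℕ) :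
    qPoch p x (m + n) = qPoch p x m * qPoch p (x * p ^ m) n := by
  simp only [qPoch, Finset.prod_range_add]
  congr 1
  exact Finset.prod_congr rfl fun j _ => by ring

lemma qPoch_ne_zero {p x : ℂ} {n : ℕ} (h : ∀ j < n, x * p ^ j ≠ 1) : qPoch p x n ≠ 0 :=
  Finset.prod_ne_zero_iff.mpr fun j hj =>
    sub_ne_zero.mpr (h j (Finset.mem_range.mp hj)).symm

lemma summable_norm_qPoch {p : ℂ} (hp : ‖p‖ < 1) (x : ℂ) :
    Summable fun j : ℕ => ‖-(x * p ^ j)‖ := by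
  simpa [norm_neg, norm_mul, norm_pow] using
    (summable_geometric_of_lt_one (norm_nonneg p) hp).mul_left ‖x‖

lemma multipliable_qPoch {p : ℂ} (hp : ‖p‖ < 1) (x : ℂ) :
    Multipliable fun j : ℕ => 1 - x * p ^ j := by
  simpa only [sub_eq_add_neg] using multipliable_one_add_of_summable (summable_norm_qPoch hp x)

lemma tendsto_qPoch {p : ℂ} (hp : ‖p‖ < 1) (x : ℂ) :
    Tendsto (qPoch p x) atTop (𝓝 (qPochInf p x)) :=
  (multipliable_qPoch hp x).hasProd.tendsto_prod_nat

lemma qPochInf_eq_mul {p : ℂ} (hp : ‖p‖ < 1) (x : ℂ) (n : ℕ) :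
    qPochInf p x = qPoch p x n * qPochInf p (x * p ^ n) := by
  refine tendsto_nhds_unique ((tendsto_add_atTop_iff_nat n).mpr (tendsto_qPoch hp x)) ?_
  simp only [add_comm _ n, qPoch_add]
  exact (tendsto_qPoch hp _).const_mul _

lemma qPochInf_ne_zero {p x : ℂ} (hp : ‖p‖ < 1) (h : ∀ j : ℕ, x * p ^ j ≠ 1) :
    qPochInf p x ≠ 0 := by
  have := tprod_one_add_ne_zero_of_summable (f := fun j : ℕ => -(x * p ^ j))
    (fun j => by rw [← sub_eq_add_neg]; exact sub_ne_zero.mpr (h j).symm)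
    (summable_norm_qPoch hp x)
  simp only [← sub_eq_add_neg] at this
  exact this

/-- From 1 + r ≤ eʳ and the geometric series. The bound does not depend on n, so it can dominate all
truncations at once. -/
lemma norm_qPoch_le {p : ℂ} (hp : ‖p‖ < 1) (x : ℂ) (n : ℕ) :
    ‖qPoch p x n‖ ≤ Real.exp (‖x‖ / (1 - ‖p‖)) := by
  have h1 : ‖qPoch p x n‖ ≤ ∏ j ∈ Finset.range n, Real.exp (‖x‖ * ‖p‖ ^ j) := by
    rw [qPoch, norm_prod]
    refine Finset.prod_le_prod (fun _ _ => norm_nonneg _) fun j _ => ?_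
    calc ‖1 - x * p ^ j‖ ≤ ‖(1 : ℂ)‖ + ‖x * p ^ j‖ := norm_sub_le _ _
      _ = ‖x‖ * ‖p‖ ^ j + 1 := by rw [norm_one, norm_mul, norm_pow, add_comm]
      _ ≤ _ := Real.add_one_le_exp _
  refine h1.trans ?_
  rw [← Real.exp_sum, Real.exp_le_exp, ← Finset.mul_sum, div_eq_mul_inv]
  refine mul_le_mul_of_nonneg_left ?_ (norm_nonneg _)
  rw [← tsum_geometric_of_lt_one (norm_nonneg p) hp]
  exact (summable_geometric_of_lt_one (norm_nonneg p) hp).sum_le_tsum _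
    fun _ _ => pow_nonneg (norm_nonneg p) _

lemma norm_qPochInf_le {p : ℂ} (hp : ‖p‖ < 1) (x : ℂ) :
    ‖qPochInf p x‖ ≤ Real.exp (‖x‖ / (1 - ‖p‖)) :=
  le_of_tendsto (tendsto_qPoch hp x).norm (Eventually.of_forall (norm_qPoch_le hp x))

lemma differentiable_qPochInf {p : ℂ} (hp : ‖p‖ < 1) : Differentiable ℂ (qPochInf p) := by
  intro x₀
  set R := ‖x₀‖ + 1
  have hU : IsOpen (Metric.ball (0 : ℂ) R) := Metric.isOpen_ball
  have hx₀ : x₀ ∈ Metric.ball (0 : ℂ) R := by simp [R]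
  -- On a ball of radius R the j-th factor differs from 1 by at most R‖p‖ʲ, so the Weierstrass test
  -- applies.
  have hloc : HasProdLocallyUniformlyOn (fun (j : ℕ) (x : ℂ) => 1 + -(x * p ^ j))
      (fun x => ∏' j : ℕ, (1 + -(x * p ^ j))) (Metric.ball (0 : ℂ) R) := by
    refine Summable.hasProdLocallyUniformlyOn_nat_one_add
      (u := fun j => R * ‖p‖ ^ j) hU
      ((summable_geometric_of_lt_one (norm_nonneg p) hp).mul_left R) ?_ ?_
    · refine Eventually.of_forall fun j x hx => ?_
      rw [norm_neg, norm_mul, norm_pow]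
      exact mul_le_mul_of_nonneg_right (by simpa using (Metric.mem_ball.mp hx).le) (by positivity)
    · intro j
      fun_prop
  have hd : DifferentiableOn ℂ (fun x => ∏' j : ℕ, (1 + -(x * p ^ j)))
      (Metric.ball (0 : ℂ) R) := by
    refine TendstoLocallyUniformlyOn.differentiableOn hloc
      (Eventually.of_forall fun s => ?_) hU
    exact DifferentiableOn.fun_finsetProd fun j _ => by fun_prop
  have := hd.differentiableAt (hU.mem_nhds hx₀)
  simp only [← sub_eq_add_neg] at this
  exact this

lemma star_qPochInf {p : ℂ} (hp : ‖p‖ < 1) (x : ℂ) :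
    star (qPochInf p x) = qPochInf (star p) (star x) := by
  have hp' : ‖star p‖ < 1 := by rwa [norm_star]
  refine tendsto_nhds_unique ((continuous_star.tendsto _).comp (tendsto_qPoch hp x)) ?_
  refine (tendsto_qPoch hp' (star x)).congr fun n => ?_
  simp [qPoch]

/-- Quotient of two instances of `(x p⁻ᵏ;p)_k = (-x)ᵏ p^{-k(k+1)/2} (p/x;p)_k`, cleared of
denominators. -/
lemma qPoch_reverse {p x y : ℂ} (hp : p ≠ 0) (hx : x ≠ 0) (hy : y ≠ 0) (k : ℕ) :
    qPoch p (x / p ^ k) k * y ^ k * qPoch p (p / y) k =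
      qPoch p (y / p ^ k) k * x ^ k * qPoch p (p / x) k := by
  have key : ∀ z : ℂ, z ≠ 0 → qPoch p (z / p ^ k) k =
      z ^ k * qPoch p (p / z) k * ∏ j ∈ Finset.range k, (-(p ^ (j + 1))⁻¹) := by
    intro z hz
    have hz' : z ^ k = ∏ _j ∈ Finset.range k, z := by simp
    rw [qPoch, ← Finset.prod_range_reflect, qPoch, hz',
      ← Finset.prod_mul_distrib, ← Finset.prod_mul_distrib]
    refine Finset.prod_congr rfl fun j hj => ?_
    have hj := Finset.mem_range.mp hj
    obtain ⟨m, rfl⟩ : ∃ m, k = m + 1 + j := ⟨k - 1 - j, by omega⟩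
    have : m + 1 + j - 1 - j = m := by omega
    rw [this]
    field_simp
    ring
  rw [key x hx, key y hy]
  ring

/-! ### Integrals along closed curves -/

section Loop

variable {γ : ℝ → ℂ}

lemma intervalIntegrable_loop (hγ : ContDiff ℝ 1 γ) {F : ℂ → ℂ}
    (hF : ContinuousOn (fun τ => F (γ τ)) (Set.Icc 0 1)) :
    IntervalIntegrable (fun τ => deriv γ τ * F (γ τ)) MeasureTheory.volume 0 1 := by
  apply ContinuousOn.intervalIntegrable
  rw [Set.uIcc_of_le zero_le_one]
  exact (hγ.continuous_deriv le_rfl).continuousOn.mul hF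

lemma loopIntegral_add (hγ : ContDiff ℝ 1 γ) {F G : ℂ → ℂ}
    (hF : ContinuousOn (fun τ => F (γ τ)) (Set.Icc 0 1))
    (hG : ContinuousOn (fun τ => G (γ τ)) (Set.Icc 0 1)) :
    loopIntegral γ (fun z => F z + G z) = loopIntegral γ F + loopIntegral γ G := by
  simp only [loopIntegral, mul_add]
  rw [intervalIntegral.integral_add (intervalIntegrable_loop hγ hF)
    (intervalIntegrable_loop hγ hG), mul_add]

lemma loopIntegral_const_mul (c : ℂ) (F : ℂ → ℂ) :
    loopIntegral γ (fun z => c * F z) = c * loopIntegral γ F := by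
  simp only [loopIntegral, mul_left_comm _ c, intervalIntegral.integral_const_mul]

lemma loopIntegral_sum (hγ : ContDiff ℝ 1 γ) {ι : Type*} (s : Finset ι) {F : ι → ℂ → ℂ}
    (hF : ∀ i ∈ s, ContinuousOn (fun τ => F i (γ τ)) (Set.Icc 0 1)) :
    loopIntegral γ (fun z => ∑ i ∈ s, F i z) = ∑ i ∈ s, loopIntegral γ (F i) := by
  simp only [loopIntegral, Finset.mul_sum]
  rw [intervalIntegral.integral_finsetSum
    fun i hi => intervalIntegrable_loop hγ (hF i hi), Finset.mul_sum]

lemma loopIntegral_congr {F G : ℂ → ℂ} (h : ∀ τ ∈ Set.Icc (0 : ℝ) 1, F (γ τ) = G (γ τ)) :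
    loopIntegral γ F = loopIntegral γ G := by
  unfold loopIntegral
  congr 1
  refine intervalIntegral.integral_congr fun τ hτ => ?_
  rw [Set.uIcc_of_le zero_le_one] at hτ
  simp only [h τ hτ]

/-- The integral of a function with a primitive along a closed curve vanishes. -/
lemma loopIntegral_eq_zero_of_hasDerivAt (hγ : ContDiff ℝ 1 γ) (hc : γ 0 = γ 1) {F f : ℂ → ℂ}
    (hF : ∀ τ ∈ Set.Icc (0 : ℝ) 1, HasDerivAt F (f (γ τ)) (γ τ))
    (hf : ContinuousOn (fun τ => f (γ τ)) (Set.Icc 0 1)) :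
    loopIntegral γ f = 0 := by
  have : ∫ τ in (0 : ℝ)..1, deriv γ τ * f (γ τ) = F (γ 1) - F (γ 0) := by
    refine intervalIntegral.integral_eq_sub_of_hasDerivAt (f := fun τ => F (γ τ))
      (fun τ hτ => ?_) (intervalIntegrable_loop hγ hf)
    rw [Set.uIcc_of_le zero_le_one] at hτ
    have hd : HasDerivAt γ (deriv γ τ) τ := (hγ.differentiable one_ne_zero τ).hasDerivAt
    have := (hF τ hτ).scomp τ hd
    rwa [smul_eq_mul] at this
  rw [loopIntegral, this, hc, sub_self, mul_zero]

/-- `γ` stays away from `w` and does not wind around it. -/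
structure Avoids (γ : ℝ → ℂ) (w : ℂ) : Prop where
  ne : ∀ τ ∈ Set.Icc (0 : ℝ) 1, γ τ ≠ w
  winding : winding γ w = 0

/-- `∏_{w ∈ l} (z - w)⁻¹`. -/
def polarProd (l : List ℂ) (z : ℂ) : ℂ := (l.map fun w => (z - w)⁻¹).prod

@[simp] lemma polarProd_nil (z : ℂ) : polarProd [] z = 1 := rfl

@[simp] lemma polarProd_cons (w : ℂ) (l : List ℂ) (z : ℂ) :
    polarProd (w :: l) z = (z - w)⁻¹ * polarProd l z := rfl

lemma polarProd_append (l l' : List ℂ) (z : ℂ) :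
    polarProd (l ++ l') z = polarProd l z * polarProd l' z := by
  simp [polarProd]

lemma continuousOn_inv_sub (hγ : ContDiff ℝ 1 γ) {w : ℂ}
    (hw : ∀ τ ∈ Set.Icc (0 : ℝ) 1, γ τ ≠ w) :
    ContinuousOn (fun τ => (γ τ - w)⁻¹) (Set.Icc 0 1) :=
  (hγ.continuous.sub continuous_const).continuousOn.inv₀
    fun τ hτ => sub_ne_zero.mpr (hw τ hτ)

lemma continuousOn_polarProd (hγ : ContDiff ℝ 1 γ) {l : List ℂ} (hl : ∀ w ∈ l, Avoids γ w) :
    ContinuousOn (fun τ => polarProd l (γ τ)) (Set.Icc 0 1) := by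
  induction l with
  | nil => exact continuousOn_const
  | cons w l ih =>
    simp only [List.mem_cons, forall_eq_or_imp] at hl
    exact (continuousOn_inv_sub hγ hl.1.ne).mul (ih hl.2)

lemma continuousOn_comp_loop (hγ : ContDiff ℝ 1 γ) {R : ℝ}
    (hR : ∀ τ ∈ Set.Icc (0 : ℝ) 1, γ τ ∈ Metric.ball (0 : ℂ) R) {g : ℂ → ℂ}
    (hg : DifferentiableOn ℂ g (Metric.ball 0 R)) :
    ContinuousOn (fun τ => g (γ τ)) (Set.Icc 0 1) :=
  hg.continuousOn.comp hγ.continuous.continuousOn hR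

/-- Exponent one is the winding number; every higher power has a primitive. -/
lemma loopIntegral_inv_pow (hγ : ContDiff ℝ 1 γ) (hc : γ 0 = γ 1) {w : ℂ} (hw : Avoids γ w)
    (n : ℕ) : loopIntegral γ (fun z => (z - w)⁻¹ ^ (n + 1)) = 0 := by
  cases n with
  | zero => simpa [AWOverlap.winding] using hw.winding
  | succ n =>
    refine loopIntegral_eq_zero_of_hasDerivAt hγ hc
      (F := fun z => -((n : ℂ) + 1)⁻¹ * (z - w)⁻¹ ^ (n + 1)) (fun τ hτ => ?_)
      ((continuousOn_inv_sub hγ hw.ne).pow _)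
    have hne : γ τ - w ≠ 0 := sub_ne_zero.mpr (hw.ne τ hτ)
    have h1 : HasDerivAt (fun z => (z - w)⁻¹) (-1 / (γ τ - w) ^ 2) (γ τ) :=
      ((hasDerivAt_id (γ τ)).sub_const w).fun_inv hne
    have hn : (n : ℂ) + 1 ≠ 0 := by exact_mod_cast Nat.succ_ne_zero n
    refine ((h1.fun_pow (n + 1)).const_mul (-((n : ℂ) + 1)⁻¹)).congr_deriv ?_
    push_cast
    have h3 : ((n : ℂ) + 1)⁻¹ * (n + 1) = 1 := inv_mul_cancel₀ hn
    rw [neg_div, one_div, ← inv_pow]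
    linear_combination (γ τ - w)⁻¹ ^ (n + 2) * h3

/-- Poles in the list may repeat (for instance when x = 1/x), so the induction carries an arbitrary
power of one pole. A repetition raises the power; a different pole is split off by partial
fractions, which lowers it. -/
lemma loopIntegral_inv_pow_mul_polarProd (hγ : ContDiff ℝ 1 γ) (hc : γ 0 = γ 1)
    (l : List ℂ) : (∀ w ∈ l, Avoids γ w) → ∀ w, Avoids γ w → ∀ n : ℕ,
      loopIntegral γ (fun z => (z - w)⁻¹ ^ (n + 1) * polarProd l z) = 0 := by
  induction l with
  | nil =>
    intro _ w hw n
    simpa using loopIntegral_inv_pow hγ hc hw n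
  | cons w' l ih =>
    intro hl w hw n
    simp only [List.mem_cons, forall_eq_or_imp] at hl
    obtain ⟨hw', hl⟩ := hl
    by_cases hww : w = w'
    · subst hww
      simpa [pow_succ, mul_assoc] using ih hl w hw (n + 1)
    · have hsub : w - w' ≠ 0 := sub_ne_zero.mpr hww
      have step : ∀ m : ℕ, loopIntegral γ (fun z => (z - w)⁻¹ ^ m * polarProd (w' :: l) z) = 0 →
          loopIntegral γ (fun z => (z - w)⁻¹ ^ (m + 1) * polarProd (w' :: l) z) = 0 := by
        intro m hm
        have : loopIntegral γ (fun z => (z - w)⁻¹ ^ (m + 1) * polarProd (w' :: l) z) =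
            loopIntegral γ (fun z => (w - w')⁻¹ * ((z - w)⁻¹ ^ (m + 1) * polarProd l z) +
              -(w - w')⁻¹ * ((z - w)⁻¹ ^ m * polarProd (w' :: l) z)) := by
          refine loopIntegral_congr fun τ hτ => ?_
          have h1 := sub_ne_zero.mpr (hw.ne τ hτ)
          have h2 := sub_ne_zero.mpr (hw'.ne τ hτ)
          have h3 : (γ τ - w)⁻¹ * (γ τ - w')⁻¹ =
              (w - w')⁻¹ * (γ τ - w)⁻¹ - (w - w')⁻¹ * (γ τ - w')⁻¹ := by
            field_simp
            ring
          simp only [polarProd_cons, pow_succ]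
          linear_combination (γ τ - w)⁻¹ ^ m * polarProd l (γ τ) * h3
        rw [this, loopIntegral_add hγ, loopIntegral_const_mul, loopIntegral_const_mul, hm,
          ih hl w hw m]
        · simp
        · exact continuousOn_const.mul (((continuousOn_inv_sub hγ hw.ne).pow _).mul
            (continuousOn_polarProd hγ hl))
        · refine continuousOn_const.mul (((continuousOn_inv_sub hγ hw.ne).pow _).mul
            (continuousOn_polarProd hγ ?_))
          simpa using ⟨hw', hl⟩
      -- With power 0 only the head `w'` and the tail remain, which is the induction hypothesis at
      -- `w'`.
      have base : loopIntegral γ (fun z => (z - w)⁻¹ ^ 0 * polarProd (w' :: l) z) = 0 := by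
        simpa using ih hl w' hw' 0
      exact Nat.rec (step 0 base) (fun m hm => step (m + 1) hm) n

lemma loopIntegral_differentiableOn (hγ : ContDiff ℝ 1 γ) (hc : γ 0 = γ 1) {R : ℝ}
    (hR : ∀ τ ∈ Set.Icc (0 : ℝ) 1, γ τ ∈ Metric.ball (0 : ℂ) R) {g : ℂ → ℂ}
    (hg : DifferentiableOn ℂ g (Metric.ball 0 R)) : loopIntegral γ g = 0 := by
  obtain ⟨G, hG⟩ := hg.isExactOn_ball
  exact loopIntegral_eq_zero_of_hasDerivAt hγ hc (fun τ hτ => hG _ (hR τ hτ))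
    (continuousOn_comp_loop hγ hR hg)

lemma sub_mul_dslope {g : ℂ → ℂ} {w z : ℂ} (h : z ≠ w) :
    g z * (z - w)⁻¹ = dslope g w z + g w * (z - w)⁻¹ := by
  rw [dslope_of_ne _ h, slope_def_field]
  ring

/-- Poles are removed one at a time. For a pole in the ball, g(z)/(z - w) is a holomorphic divided
difference plus g(w)/(z - w); for a pole outside, the factor is holomorphic on the ball and is
absorbed into g. -/
lemma loopIntegral_mul_polarProd (hγ : ContDiff ℝ 1 γ) (hc : γ 0 = γ 1) {R : ℝ}
    (hR : ∀ τ ∈ Set.Icc (0 : ℝ) 1, γ τ ∈ Metric.ball (0 : ℂ) R) (l : List ℂ)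
    (hl : ∀ w ∈ l, Avoids γ w) : ∀ g : ℂ → ℂ, DifferentiableOn ℂ g (Metric.ball 0 R) →
      loopIntegral γ (fun z => g z * polarProd l z) = 0 := by
  induction l with
  | nil =>
    intro g hg
    simpa using loopIntegral_differentiableOn hγ hc hR hg
  | cons w l ih =>
    intro g hg
    simp only [List.mem_cons, forall_eq_or_imp] at hl
    obtain ⟨hw, hl⟩ := hl
    by_cases hwR : w ∈ Metric.ball (0 : ℂ) R
    · have hd : DifferentiableOn ℂ (dslope g w) (Metric.ball 0 R) :=
        (Complex.differentiableOn_dslope (Metric.isOpen_ball.mem_nhds hwR)).mpr hg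
      have : loopIntegral γ (fun z => g z * polarProd (w :: l) z) =
          loopIntegral γ (fun z => dslope g w z * polarProd l z +
            g w * ((z - w)⁻¹ ^ (0 + 1) * polarProd l z)) := by
        refine loopIntegral_congr fun τ hτ => ?_
        rw [polarProd_cons, ← mul_assoc, sub_mul_dslope (hw.ne τ hτ)]
        ring
      rw [this, loopIntegral_add hγ, loopIntegral_const_mul, ih hl _ hd,
        loopIntegral_inv_pow_mul_polarProd hγ hc l hl w hw 0]
      · simp
      · exact (continuousOn_comp_loop hγ hR hd).mul (continuousOn_polarProd hγ hl)
      · exact continuousOn_const.mul (((continuousOn_inv_sub hγ hw.ne).pow _).mul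
          (continuousOn_polarProd hγ hl))
    · have hd : DifferentiableOn ℂ (fun z => g z * (z - w)⁻¹) (Metric.ball 0 R) :=
        hg.mul ((differentiableOn_id.sub_const w).inv
          fun z hz => sub_ne_zero.mpr fun h => hwR (h ▸ hz))
      simpa [mul_assoc] using ih hl _ hd

/-- Cauchy's integral formula along `γ` for a function with poles around which `γ` does not
wind. -/
lemma loopIntegral_mul_polarProd_mul_inv (hγ : ContDiff ℝ 1 γ) (hc : γ 0 = γ 1) {R : ℝ}
    (hR : ∀ τ ∈ Set.Icc (0 : ℝ) 1, γ τ ∈ Metric.ball (0 : ℂ) R) {w₀ : ℂ}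
    (hw₀R : w₀ ∈ Metric.ball (0 : ℂ) R) (hw₀ : ∀ τ ∈ Set.Icc (0 : ℝ) 1, γ τ ≠ w₀)
    (hw₀' : winding γ w₀ = 1) {g : ℂ → ℂ} (hg : DifferentiableOn ℂ g (Metric.ball 0 R))
    (l : List ℂ) (hl : ∀ w ∈ l, Avoids γ w) :
    loopIntegral γ (fun z => g z * polarProd l z * (z - w₀)⁻¹) = g w₀ * polarProd l w₀ := by
  induction l with
  | nil =>
    have hd : DifferentiableOn ℂ (dslope g w₀) (Metric.ball 0 R) :=
      (Complex.differentiableOn_dslope (Metric.isOpen_ball.mem_nhds hw₀R)).mpr hg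
    have : loopIntegral γ (fun z => g z * polarProd [] z * (z - w₀)⁻¹) =
        loopIntegral γ (fun z => dslope g w₀ z + g w₀ * (z - w₀)⁻¹) :=
      loopIntegral_congr fun τ hτ => by
        rw [polarProd_nil, mul_one, sub_mul_dslope (hw₀ τ hτ)]
    rw [this, loopIntegral_add hγ, loopIntegral_const_mul,
      loopIntegral_differentiableOn hγ hc hR hd, show loopIntegral γ (fun z => (z - w₀)⁻¹) = 1
        from hw₀']
    · simp
    · exact continuousOn_comp_loop hγ hR hd
    · exact continuousOn_const.mul (continuousOn_inv_sub hγ hw₀)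
  | cons w l ih =>
    have hl' := hl
    simp only [List.mem_cons, forall_eq_or_imp] at hl
    obtain ⟨hw, hl⟩ := hl
    -- The winding numbers 1 and 0 differ, so the points do.
    have hne : w₀ - w ≠ 0 := by
      intro h
      rw [sub_eq_zero.mp h, hw.winding] at hw₀'
      exact zero_ne_one hw₀'
    have hgc := continuousOn_comp_loop hγ hR hg
    have : loopIntegral γ (fun z => g z * polarProd (w :: l) z * (z - w₀)⁻¹) =
        loopIntegral γ (fun z => (w₀ - w)⁻¹ * (g z * polarProd l z * (z - w₀)⁻¹) +
          -(w₀ - w)⁻¹ * (g z * polarProd (w :: l) z)) := by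
      refine loopIntegral_congr fun τ hτ => ?_
      have h1 := sub_ne_zero.mpr (hw.ne τ hτ)
      have h2 := sub_ne_zero.mpr (hw₀ τ hτ)
      have h3 : (γ τ - w)⁻¹ * (γ τ - w₀)⁻¹ =
          (w₀ - w)⁻¹ * (γ τ - w₀)⁻¹ - (w₀ - w)⁻¹ * (γ τ - w)⁻¹ := by
        field_simp
        ring
      simp only [polarProd_cons]
      linear_combination g (γ τ) * polarProd l (γ τ) * h3
    rw [this, loopIntegral_add hγ, loopIntegral_const_mul, loopIntegral_const_mul, ih hl,
      loopIntegral_mul_polarProd hγ hc hR _ hl' g hg, polarProd_cons]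
    · ring
    · exact continuousOn_const.mul ((hgc.mul (continuousOn_polarProd hγ hl)).mul
        (continuousOn_inv_sub hγ hw₀))
    · exact continuousOn_const.mul (hgc.mul (continuousOn_polarProd hγ hl'))

/-! ### Functions whose poles lie outside the contour -/

/-- Functions that are holomorphic on the ball of radius `R` up to finitely many poles around
which `γ` does not wind. -/
def OuterMero (γ : ℝ → ℂ) (R : ℝ) (E : ℂ → ℂ) : Prop :=
  ∃ (g : ℂ → ℂ) (l : List ℂ), DifferentiableOn ℂ g (Metric.ball 0 R) ∧
    (∀ w ∈ l, Avoids γ w) ∧ ∀ z, E z = g z * polarProd l z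

lemma OuterMero.mul {R : ℝ} {E F : ℂ → ℂ} (hE : OuterMero γ R E) (hF : OuterMero γ R F) :
    OuterMero γ R (fun z => E z * F z) := by
  obtain ⟨g, l, hg, hl, hE⟩ := hE
  obtain ⟨g', l', hg', hl', hF⟩ := hF
  refine ⟨fun z => g z * g' z, l ++ l', hg.mul hg', fun w hw => ?_, fun z => ?_⟩
  · exact (List.mem_append.mp hw).elim (hl w) (hl' w)
  · simp only [hE, hF, polarProd_append]
    ring

lemma OuterMero.of_differentiable {R : ℝ} {g : ℂ → ℂ} (hg : Differentiable ℂ g) :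
    OuterMero γ R g :=
  ⟨g, [], hg.differentiableOn, by simp, by simp⟩

lemma OuterMero.continuousOn (hγ : ContDiff ℝ 1 γ) {R : ℝ}
    (hR : ∀ τ ∈ Set.Icc (0 : ℝ) 1, γ τ ∈ Metric.ball (0 : ℂ) R) {E : ℂ → ℂ}
    (hE : OuterMero γ R E) : ContinuousOn (fun τ => E (γ τ)) (Set.Icc 0 1) := by
  obtain ⟨g, l, hg, hl, hE⟩ := hE
  simp only [hE]
  exact (continuousOn_comp_loop hγ hR hg).mul (continuousOn_polarProd hγ hl)

lemma OuterMero.inv_qPoch {p B : ℂ} {R : ℝ} (hp0 : p ≠ 0) (hB : B ≠ 0)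
    (hw : ∀ k : ℕ, Avoids γ (1 / (B * p ^ k))) (n : ℕ) :
    OuterMero γ R (fun z => (qPoch p (B * z) n)⁻¹) := by
  induction n with
  | zero => exact ⟨fun _ => 1, [], by fun_prop, by simp, by simp [qPoch_zero]⟩
  | succ n ih =>
    have h1 : OuterMero γ R (fun z => (1 - B * z * p ^ n)⁻¹) := by
      refine ⟨fun _ => -(B * p ^ n)⁻¹, [1 / (B * p ^ n)], by fun_prop, by simpa using hw n, ?_⟩
      intro z
      have hBn : B * p ^ n ≠ 0 := mul_ne_zero hB (pow_ne_zero _ hp0)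
      have : 1 - B * z * p ^ n = -(B * p ^ n) * (z - 1 / (B * p ^ n)) := by
        field_simp
        ring
      simp only [this, mul_inv, polarProd_cons, polarProd_nil, mul_one, inv_neg]
    simpa only [qPoch_succ, mul_inv] using ih.mul h1

lemma OuterMero.inv_qPochInf {p B : ℂ} {R : ℝ} (hp : ‖p‖ < 1) (hp0 : p ≠ 0) (hB : B ≠ 0)
    (hw : ∀ k : ℕ, Avoids γ (1 / (B * p ^ k))) :
    OuterMero γ R (fun z => (qPochInf p (B * z))⁻¹) := by
  -- Beyond index n no factor vanishes on the ball, so only the first n factors contribute poles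
  -- there.
  obtain ⟨n, hn⟩ : ∃ n : ℕ, ‖B‖ * R * ‖p‖ ^ n < 1 := by
    have : Tendsto (fun n : ℕ => ‖B‖ * R * ‖p‖ ^ n) atTop (𝓝 (‖B‖ * R * 0)) :=
      (tendsto_pow_atTop_nhds_zero_of_lt_one (norm_nonneg p) hp).const_mul _
    rw [mul_zero] at this
    exact (this.eventually_lt_const one_pos).exists
  have h2 : OuterMero γ R (fun z => (qPochInf p (B * z * p ^ n))⁻¹) := by
    refine ⟨_, [], ?_, by simp, fun z => by rw [polarProd_nil, mul_one]⟩
    refine DifferentiableOn.inv ?_ fun z hz => ?_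
    · exact ((differentiable_qPochInf hp).comp (by fun_prop :
        Differentiable ℂ fun z => B * z * p ^ n)).differentiableOn
    · refine qPochInf_ne_zero hp fun j hj => ?_
      have hzR : ‖z‖ < R := by simpa using hz
      have h3 := congrArg norm hj
      simp only [norm_mul, norm_pow, norm_one] at h3
      have h4 : ‖p‖ ^ j ≤ 1 := pow_le_one₀ (norm_nonneg p) hp.le
      have h5 : ‖B‖ * ‖z‖ * ‖p‖ ^ n ≤ ‖B‖ * R * ‖p‖ ^ n := by gcongr
      have h6 : ‖B‖ * ‖z‖ * ‖p‖ ^ n * ‖p‖ ^ j ≤ ‖B‖ * ‖z‖ * ‖p‖ ^ n :=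
        mul_le_of_le_one_right (by positivity) h4
      linarith
  have := (OuterMero.inv_qPoch (R := R) hp0 hB hw n).mul h2
  simp only [← mul_inv, ← qPochInf_eq_mul hp] at this
  exact this

lemma OuterMero.loopIntegral_mul_inv (hγ : ContDiff ℝ 1 γ) (hc : γ 0 = γ 1) {R : ℝ}
    (hR : ∀ τ ∈ Set.Icc (0 : ℝ) 1, γ τ ∈ Metric.ball (0 : ℂ) R) {w₀ : ℂ}
    (hw₀R : w₀ ∈ Metric.ball (0 : ℂ) R) (hw₀ : ∀ τ ∈ Set.Icc (0 : ℝ) 1, γ τ ≠ w₀)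
    (hw₀' : AWOverlap.winding γ w₀ = 1) {E : ℂ → ℂ} (hE : OuterMero γ R E) :
    loopIntegral γ (fun z => E z * (z - w₀)⁻¹) = E w₀ := by
  obtain ⟨g, l, hg, hl, hE⟩ := hE
  simp only [hE]
  exact loopIntegral_mul_polarProd_mul_inv hγ hc hR hw₀R hw₀ hw₀' hg l hl

/-- The residue theorem for finitely many simple poles, each encircled once. -/
lemma OuterMero.loopIntegral_mul_prod_inv (hγ : ContDiff ℝ 1 γ) (hc : γ 0 = γ 1) {R : ℝ}
    (hR : ∀ τ ∈ Set.Icc (0 : ℝ) 1, γ τ ∈ Metric.ball (0 : ℂ) R) {ι : Type*} [DecidableEq ι]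
    {s : Finset ι} (hs : s.Nonempty) {w : ι → ℂ} (hinj : Set.InjOn w s)
    (hwR : ∀ i ∈ s, w i ∈ Metric.ball (0 : ℂ) R)
    (hw : ∀ i ∈ s, ∀ τ ∈ Set.Icc (0 : ℝ) 1, γ τ ≠ w i)
    (hw' : ∀ i ∈ s, AWOverlap.winding γ (w i) = 1) {E : ℂ → ℂ} (hE : OuterMero γ R E) :
    loopIntegral γ (fun z => E z * ∏ i ∈ s, (z - w i)⁻¹) =
      ∑ i ∈ s, (∏ j ∈ s.erase i, (w i - w j)⁻¹) * E (w i) := by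
  have h1 : loopIntegral γ (fun z => E z * ∏ i ∈ s, (z - w i)⁻¹) =
      loopIntegral γ (fun z => ∑ i ∈ s, Lagrange.nodalWeight s w i * (E z * (z - w i)⁻¹)) := by
    refine loopIntegral_congr fun τ hτ => ?_
    have hne : ∀ i ∈ s, γ τ ≠ w i := fun i hi => hw i hi τ hτ
    -- Interpolating the constant 1 gives the partial fraction expansion of ∏ (z - wᵢ)⁻¹, whose
    -- coefficients are the nodal weights.
    have h2 := Lagrange.eval_interpolate_not_at_node (r := fun _ => (1 : ℂ)) hne
    rw [show (fun _ => (1 : ℂ)) = (1 : ι → ℂ) from rfl, Lagrange.interpolate_one hinj hs,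
      Polynomial.eval_one, Lagrange.eval_nodal] at h2
    have h3 : ∏ i ∈ s, (γ τ - w i) ≠ 0 :=
      Finset.prod_ne_zero_iff.mpr fun i hi => sub_ne_zero.mpr (hne i hi)
    rw [Finset.prod_inv_distrib, inv_eq_of_mul_eq_one_right h2.symm, Finset.mul_sum]
    exact Finset.sum_congr rfl fun i _ => by ring
  rw [h1, loopIntegral_sum hγ]
  · refine Finset.sum_congr rfl fun i hi => ?_
    rw [loopIntegral_const_mul, hE.loopIntegral_mul_inv hγ hc hR (hwR i hi) (hw i hi) (hw' i hi),
      Lagrange.nodalWeight]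
  · exact fun i hi => continuousOn_const.mul
      ((hE.continuousOn hγ hR).mul (continuousOn_inv_sub hγ (hw i hi)))

end Loop

/-! ### Residues of the truncated integrand -/

section Nodes

lemma prod_sub_eq_pow_mul_qPoch {p z : ℂ} (x : ℂ) (hz : z ≠ 0) (n : ℕ) :
    ∏ j ∈ Finset.range n, (z - x * p ^ j) = z ^ n * qPoch p (x / z) n := by
  have : z ^ n = ∏ _j ∈ Finset.range n, z := by simp
  rw [qPoch, this, ← Finset.prod_mul_distrib]
  refine Finset.prod_congr rfl fun j _ => ?_
  field_simp

/-- The first poles `0, σ pᵏ, τ pᵏ` of the truncated integrand. -/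
def node (p σ τ : ℂ) : Option (ℕ ⊕ ℕ) → ℂ
  | none => 0
  | some (Sum.inl k) => σ * p ^ k
  | some (Sum.inr k) => τ * p ^ k

/-- The indices of the first `1 + 2N` nodes. -/
def nodeSet (N : ℕ) : Finset (Option (ℕ ⊕ ℕ)) :=
  Finset.insertNone ((Finset.range N).disjSum (Finset.range N))

lemma prod_nodeSet (N : ℕ) (f : Option (ℕ ⊕ ℕ) → ℂ) :
    ∏ i ∈ nodeSet N, f i = f none * ((∏ j ∈ Finset.range N, f (some (Sum.inl j))) *
      ∏ j ∈ Finset.range N, f (some (Sum.inr j))) := by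
  rw [nodeSet, Finset.prod_insertNone, Finset.prod_disjSum]

lemma sum_nodeSet (N : ℕ) (f : Option (ℕ ⊕ ℕ) → ℂ) :
    ∑ i ∈ nodeSet N, f i = f none + ((∑ j ∈ Finset.range N, f (some (Sum.inl j))) +
      ∑ j ∈ Finset.range N, f (some (Sum.inr j))) := by
  rw [nodeSet, Finset.sum_insertNone, Finset.sum_disjSum]

/-- Keeping the omitted index with factor 1 lets the product split over the three kinds of nodes. -/
lemma prod_erase_nodeSet (N : ℕ) (i : Option (ℕ ⊕ ℕ)) (f : Option (ℕ ⊕ ℕ) → ℂ) :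
    ∏ j ∈ (nodeSet N).erase i, f j = ∏ j ∈ nodeSet N, if j = i then 1 else f j := by
  rw [← Finset.prod_erase (a := i) (nodeSet N) (by simp)]
  exact Finset.prod_congr rfl fun j hj => by rw [if_neg (Finset.ne_of_mem_erase hj)]

/-- `∏_{j<k+1+m, j≠k} (1 - p^{j-k}) = (p⁻ᵏ;p)_k (p;p)_m`. -/
lemma prod_range_ite_ne {p x : ℂ} (hp : p ≠ 0) (hx : x ≠ 0) (k m : ℕ) :
    (∏ j ∈ Finset.range (k + 1 + m), if j = k then (1 : ℂ) else (x * p ^ k - x * p ^ j)⁻¹) =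
      ((x * p ^ k) ^ (k + m) * (qPoch p (1 / p ^ k) k * qPoch p p m))⁻¹ := by
  have hz : x * p ^ k ≠ 0 := mul_ne_zero hx (pow_ne_zero _ hp)
  rw [Finset.prod_range_add, Finset.prod_range_succ, if_pos rfl, mul_one]
  have h1 : (∏ j ∈ Finset.range k, if j = k then (1 : ℂ) else (x * p ^ k - x * p ^ j)⁻¹) =
      ((x * p ^ k) ^ k * qPoch p (1 / p ^ k) k)⁻¹ := by
    rw [show 1 / p ^ k = x / (x * p ^ k) by field_simp, ← prod_sub_eq_pow_mul_qPoch x hz,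
      ← Finset.prod_inv_distrib]
    exact Finset.prod_congr rfl fun j hj => by rw [if_neg (Finset.mem_range.mp hj).ne]
  have h2 : (∏ j ∈ Finset.range m,
      if k + 1 + j = k then (1 : ℂ) else (x * p ^ k - x * p ^ (k + 1 + j))⁻¹) =
      ((x * p ^ k) ^ m * qPoch p p m)⁻¹ := by
    have : p = x * p ^ (k + 1) / (x * p ^ k) := by field_simp; ring
    conv_rhs => rw [show qPoch p p m = qPoch p (x * p ^ (k + 1) / (x * p ^ k)) m by rw [← this]]
    rw [← prod_sub_eq_pow_mul_qPoch _ hz, ← Finset.prod_inv_distrib]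
    refine Finset.prod_congr rfl fun j _ => ?_
    rw [if_neg (by omega), pow_add p (k + 1) j, mul_assoc]
  rw [h1, h2, pow_add]
  simp only [mul_inv]
  ring

/-- The residue of the truncated integrand at `σ pᵏ`. -/
lemma residue_eq {p σ τ μ ν : ℂ} (hp : p ≠ 0) (hσ : σ ≠ 0) (hτ : τ ≠ 0) (hμ : μ ≠ 0)
    (hν : ν ≠ 0) (hμν : μ * ν = p * σ * τ) (hpp : ∀ j : ℕ, p * p ^ j ≠ 1)
    (hτσ : ∀ j k : ℕ, σ * p ^ j ≠ τ * p ^ k) (k m : ℕ) :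
    (σ * p ^ k)⁻¹ * ((∏ j ∈ Finset.range (k + 1 + m),
        if j = k then (1 : ℂ) else (σ * p ^ k - σ * p ^ j)⁻¹) *
        ∏ j ∈ Finset.range (k + 1 + m), (σ * p ^ k - τ * p ^ j)⁻¹) *
      ((∏ j ∈ Finset.range (k + 1 + m), (σ * p ^ k - μ * p ^ j)) *
        ∏ j ∈ Finset.range (k + 1 + m), (σ * p ^ k - ν * p ^ j)) =
    p ^ k * (qPoch p (p * σ / μ) k * qPoch p (p * σ / ν) k /
        (qPoch p p k * qPoch p (p * σ / τ) k)) *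
      (qPoch p (μ / σ) (m + 1) * qPoch p (ν / σ) (m + 1) /
        (qPoch p p m * qPoch p (τ / σ) (m + 1))) := by
  have hz : σ * p ^ k ≠ 0 := mul_ne_zero hσ (pow_ne_zero _ hp)
  have split : ∀ x : ℂ, ∏ j ∈ Finset.range (k + 1 + m), (σ * p ^ k - x * p ^ j) =
      (σ * p ^ k) ^ (k + 1 + m) * (qPoch p (x / σ / p ^ k) k * qPoch p (x / σ) (m + 1)) := by
    intro x
    rw [prod_sub_eq_pow_mul_qPoch x hz, show k + 1 + m = k + (m + 1) by ring,
      qPoch_add, ← div_div, div_mul_cancel₀ _ (pow_ne_zero _ hp)]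
  rw [prod_range_ite_ne hp hσ, Finset.prod_inv_distrib, split, split, split]
  have ppow : ∀ j : ℕ, p ^ j ≠ 0 := fun j => pow_ne_zero _ hp
  have n1 : qPoch p p k ≠ 0 := qPoch_ne_zero fun j _ => hpp j
  have n2 : qPoch p p m ≠ 0 := qPoch_ne_zero fun j _ => hpp j
  have n3 : qPoch p (p * σ / τ) k ≠ 0 := qPoch_ne_zero fun j _ h => by
    refine hτσ (j + 1) 0 ?_
    field_simp at h
    linear_combination h
  have n4 : qPoch p (τ / σ) (m + 1) ≠ 0 := qPoch_ne_zero fun j _ h => by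
    refine hτσ 0 j ?_
    field_simp at h
    linear_combination -h
  have n5 : qPoch p (1 / p ^ k) k ≠ 0 := qPoch_ne_zero fun j hj h => by
    obtain ⟨i, rfl⟩ : ∃ i, k = j + (i + 1) := ⟨k - j - 1, by omega⟩
    refine hpp i ?_
    have := ppow j
    rw [pow_add] at h
    field_simp at h
    rw [pow_succ] at h
    linear_combination -h
  have n6 : qPoch p (τ / σ / p ^ k) k ≠ 0 := qPoch_ne_zero fun j hj h => by
    refine hτσ k j ?_
    field_simp at h
    linear_combination -h
  -- Reversal turns the factors with base point x/(σ pᵏ) into the shifted factorials of pσ/x that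
  -- occur in the series.
  have r1 := qPoch_reverse hp (div_ne_zero hμ hσ) (one_ne_zero) k
  have r2 := qPoch_reverse hp (div_ne_zero hν hσ) (div_ne_zero hτ hσ) k
  have e1 : ∀ x : ℂ, p / (x / σ) = p * σ / x := fun x => by rw [div_div_eq_mul_div]
  rw [e1] at r1 r2
  rw [e1] at r2
  rw [one_pow, mul_one, div_one] at r1
  -- The powers left over by the two reversals combine, by the balancing relation, to the factor pᵏ.
  have hpk : (μ / σ) ^ k * (ν / σ) ^ k = p ^ k * (τ / σ) ^ k := by
    rw [← mul_pow, ← mul_pow]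
    congr 1
    field_simp
    linear_combination hμν
  have hτk : (τ / σ) ^ k ≠ 0 := pow_ne_zero _ (div_ne_zero hτ hσ)
  have key : qPoch p (μ / σ / p ^ k) k * qPoch p (ν / σ / p ^ k) k *
      (qPoch p p k * qPoch p (p * σ / τ) k) =
      p ^ k * (qPoch p (p * σ / μ) k * qPoch p (p * σ / ν) k) *
        (qPoch p (1 / p ^ k) k * qPoch p (τ / σ / p ^ k) k) := by
    apply mul_right_cancel₀ hτk
    linear_combination (qPoch p (ν / σ / p ^ k) k * (τ / σ) ^ k * qPoch p (p * σ / τ) k) * r1 +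
      qPoch p (1 / p ^ k) k * (μ / σ) ^ k * qPoch p (p * σ / μ) k * r2 +
      qPoch p (1 / p ^ k) k * qPoch p (p * σ / μ) k * qPoch p (τ / σ / p ^ k) k *
        qPoch p (p * σ / ν) k * hpk
  set Z := σ * p ^ k
  have hZ : Z ^ (k + 1 + m) = Z * Z ^ (k + m) := by ring
  rw [hZ]
  have hZ' : Z ^ (k + m) ≠ 0 := pow_ne_zero _ hz
  generalize Z ^ (k + m) = Y at *
  generalize qPoch p (1 / p ^ k) k = a1 at *
  generalize qPoch p (τ / σ / p ^ k) k = a2 at *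
  generalize qPoch p (μ / σ / p ^ k) k = a3 at *
  generalize qPoch p (ν / σ / p ^ k) k = a4 at *
  generalize qPoch p p k = b1 at *
  generalize qPoch p (p * σ / τ) k = b2 at *
  generalize qPoch p (τ / σ) (m + 1) = b3 at *
  generalize qPoch p (p * σ / μ) k = b4 at *
  generalize qPoch p (p * σ / ν) k = b5 at *
  field_simp
  linear_combination qPoch p (μ / σ) (m + 1) * qPoch p (ν / σ) (m + 1) * key

end Nodes

/-! ### Passage from the truncations to the full integrand -/

/-- The sum of the residues at `σ pᵏ`, `k ≥ 0`, of
`E(z) (μ/z, ν/z;p)_∞ / (z (σ/z, τ/z;p)_∞)`. -/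
def residueSum (p σ τ μ ν : ℂ) (E : ℂ → ℂ) : ℂ :=
  qPochInf p (μ / σ) * qPochInf p (ν / σ) / (qPochInf p p * qPochInf p (τ / σ)) *
    ∑' k : ℕ, p ^ k * (qPoch p (p * σ / μ) k * qPoch p (p * σ / ν) k /
      (qPoch p p k * qPoch p (p * σ / τ) k)) * E (σ * p ^ k)

lemma mul_pow_ne_one {p : ℂ} (hp : ‖p‖ < 1) (j : ℕ) : p * p ^ j ≠ 1 := by
  intro h
  have h1 := congrArg norm h
  rw [← pow_succ', norm_pow, norm_one] at h1
  exact (pow_lt_one₀ (norm_nonneg p) hp j.succ_ne_zero).ne h1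

lemma tendsto_mul_pow {p : ℂ} (hp : ‖p‖ < 1) (σ : ℂ) :
    Tendsto (fun k : ℕ => σ * p ^ k) atTop (𝓝 0) := by
  simpa using (tendsto_pow_atTop_nhds_zero_of_norm_lt_one hp).const_mul σ

/-- The residues of the truncated integrands converge to those of the integrand. -/
lemma tendsto_sum_residue {p σ τ μ ν : ℂ} (hp : ‖p‖ < 1) (hσ : σ ≠ 0) (hτ : τ ≠ 0)
    (hτσ : ∀ j k : ℕ, σ * p ^ j ≠ τ * p ^ k) {E : ℂ → ℂ} (hE : ContinuousAt E 0) :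
    Tendsto (fun N : ℕ => ∑ k ∈ Finset.range N,
      p ^ k * (qPoch p (p * σ / μ) k * qPoch p (p * σ / ν) k /
          (qPoch p p k * qPoch p (p * σ / τ) k)) *
        (qPoch p (μ / σ) (N - 1 - k + 1) * qPoch p (ν / σ) (N - 1 - k + 1) /
          (qPoch p p (N - 1 - k) * qPoch p (τ / σ) (N - 1 - k + 1))) * E (σ * p ^ k))
      atTop (𝓝 (residueSum p σ τ μ ν E)) := by
  -- The k-th residue factors as pᵏ U(k) V(N-1-k) E(σ pᵏ). The sequences U, V and E(σ pᵏ) converge,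
  -- hence are bounded, and ‖p‖ᵏ supplies a summable bound uniform in N.
  set U : ℕ → ℂ := fun k => qPoch p (p * σ / μ) k * qPoch p (p * σ / ν) k /
    (qPoch p p k * qPoch p (p * σ / τ) k)
  set V : ℕ → ℂ := fun m => qPoch p (μ / σ) (m + 1) * qPoch p (ν / σ) (m + 1) /
    (qPoch p p m * qPoch p (τ / σ) (m + 1))
  have hpp := mul_pow_ne_one hp
  have hτ1 : ∀ j : ℕ, τ / σ * p ^ j ≠ 1 := fun j h => by
    refine hτσ 0 j ?_
    field_simp at h
    linear_combination -h
  have hτ2 : ∀ j : ℕ, p * σ / τ * p ^ j ≠ 1 := fun j h => by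
    refine hτσ (j + 1) 0 ?_
    field_simp at h
    linear_combination h
  have hVlim : Tendsto V atTop (𝓝 (qPochInf p (μ / σ) * qPochInf p (ν / σ) /
      (qPochInf p p * qPochInf p (τ / σ)))) := by
    have ht : ∀ x : ℂ, Tendsto (fun m => qPoch p x (m + 1)) atTop (𝓝 (qPochInf p x)) :=
      fun x => (tendsto_add_atTop_iff_nat 1).mpr (tendsto_qPoch hp x)
    exact ((ht _).mul (ht _)).div ((tendsto_qPoch hp p).mul (ht _))
      (mul_ne_zero (qPochInf_ne_zero hp hpp) (qPochInf_ne_zero hp hτ1))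
  obtain ⟨CV, hCV⟩ := hVlim.norm.bddAbove_range
  have hVlim' : ∀ k : ℕ, Tendsto (fun N => V (N - 1 - k)) atTop
      (𝓝 (qPochInf p (μ / σ) * qPochInf p (ν / σ) / (qPochInf p p * qPochInf p (τ / σ)))) :=
    fun k => hVlim.comp ((tendsto_sub_atTop_nat k).comp (tendsto_sub_atTop_nat 1))
  have hUlim : Tendsto U atTop (𝓝 (qPochInf p (p * σ / μ) * qPochInf p (p * σ / ν) /
      (qPochInf p p * qPochInf p (p * σ / τ)))) :=
    ((tendsto_qPoch hp _).mul (tendsto_qPoch hp _)).div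
      ((tendsto_qPoch hp p).mul (tendsto_qPoch hp _))
      (mul_ne_zero (qPochInf_ne_zero hp hpp) (qPochInf_ne_zero hp hτ2))
  obtain ⟨CU, hCU⟩ := hUlim.norm.bddAbove_range
  obtain ⟨CE, hCE⟩ := (hE.tendsto.comp (tendsto_mul_pow hp σ)).norm.bddAbove_range
  have hCV' : ∀ m, ‖V m‖ ≤ CV := fun m => hCV ⟨m, rfl⟩
  have hCU' : ∀ m, ‖U m‖ ≤ CU := fun m => hCU ⟨m, rfl⟩
  have hCE' : ∀ m, ‖E (σ * p ^ m)‖ ≤ CE := fun m => hCE ⟨m, rfl⟩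
  have hV0 : 0 ≤ CV := (norm_nonneg _).trans (hCV' 0)
  have hU0 : 0 ≤ CU := (norm_nonneg _).trans (hCU' 0)
  have hE0 : 0 ≤ CE := (norm_nonneg _).trans (hCE' 0)
  have main := tendsto_tsum_of_dominated_convergence (𝓕 := atTop)
    (f := fun N k => if k < N then p ^ k * U k * V (N - 1 - k) * E (σ * p ^ k) else 0)
    (g := fun k => (qPochInf p (μ / σ) * qPochInf p (ν / σ) /
      (qPochInf p p * qPochInf p (τ / σ))) * (p ^ k * U k * E (σ * p ^ k)))
    (bound := fun k => ‖p‖ ^ k * (CU * CV * CE))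
    ((summable_geometric_of_lt_one (norm_nonneg p) hp).mul_right _) ?_ ?_
  · rw [tsum_mul_left] at main
    refine main.congr fun N => ?_
    rw [tsum_eq_sum (s := Finset.range N)]
    · exact Finset.sum_congr rfl fun k hk => if_pos (Finset.mem_range.mp hk)
    · exact fun k hk => if_neg fun h => hk (Finset.mem_range.mpr h)
  · intro k
    have h1 := ((hVlim' k).const_mul (p ^ k * U k)).mul_const (E (σ * p ^ k))
    have h2 : Tendsto (fun N => p ^ k * U k * V (N - 1 - k) * E (σ * p ^ k)) atTop
        (𝓝 ((qPochInf p (μ / σ) * qPochInf p (ν / σ) /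
          (qPochInf p p * qPochInf p (τ / σ))) * (p ^ k * U k * E (σ * p ^ k)))) := by
      convert h1 using 2
      ring
    refine h2.congr' ?_
    filter_upwards [eventually_gt_atTop k] with N hN
    rw [if_pos hN]
  · refine Eventually.of_forall fun N k => ?_
    split_ifs
    · calc ‖p ^ k * U k * V (N - 1 - k) * E (σ * p ^ k)‖
          = ‖p‖ ^ k * (‖U k‖ * ‖V (N - 1 - k)‖ * ‖E (σ * p ^ k)‖) := by
            simp only [norm_mul, norm_pow]
            ring
        _ ≤ _ := by
            refine mul_le_mul_of_nonneg_left ?_ (by positivity)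
            exact mul_le_mul (mul_le_mul (hCU' k) (hCV' _) (norm_nonneg _) hU0) (hCE' k)
              (norm_nonneg _) (mul_nonneg hU0 hV0)
    · rw [norm_zero]
      positivity

/-- `γ` passes once around `w`. -/
structure Encircles (γ : ℝ → ℂ) (w : ℂ) : Prop where
  ne : ∀ τ ∈ Set.Icc (0 : ℝ) 1, γ τ ≠ w
  winding : winding γ w = 1

section Kernel

variable {γ : ℝ → ℂ} {p σ τ μ ν : ℂ} {E : ℂ → ℂ}

lemma exists_ball (hγ : ContDiff ℝ 1 γ) (hp : ‖p‖ < 1) (σ τ : ℂ) :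
    ∃ R : ℝ, (∀ t ∈ Set.Icc (0 : ℝ) 1, γ t ∈ Metric.ball (0 : ℂ) R) ∧
      ∀ i, node p σ τ i ∈ Metric.ball (0 : ℂ) R := by
  obtain ⟨C, hC⟩ := (isCompact_Icc (a := (0 : ℝ)) (b := 1)).exists_bound_of_continuousOn
    hγ.continuous.continuousOn
  refine ⟨max C (‖σ‖ + ‖τ‖) + 1, fun t ht => ?_, fun i => ?_⟩
  · simpa using (hC t ht).trans_lt ((le_max_left _ _).trans_lt (lt_add_one _))
  · have hk : ∀ (x : ℂ) (k : ℕ), ‖x * p ^ k‖ ≤ ‖x‖ := fun x k => by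
      rw [norm_mul, norm_pow]
      exact mul_le_of_le_one_right (norm_nonneg x) (pow_le_one₀ (norm_nonneg p) hp.le)
    have h0 := le_max_right C (‖σ‖ + ‖τ‖)
    have h1 := norm_nonneg σ
    have h2 := norm_nonneg τ
    rw [mem_ball_zero_iff]
    rcases i with _ | k | k
    · simp only [node, norm_zero]
      linarith
    · have := hk σ k
      simp only [node]
      linarith
    · have := hk τ k
      simp only [node]
      linarith

/-- Distinctness of the nodes is what makes all poles of the truncated integrand simple. -/
lemma node_injective (hp : ‖p‖ < 1) (hp0 : p ≠ 0) (hσ : σ ≠ 0) (hτ : τ ≠ 0)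
    (hτσ : ∀ j k : ℕ, σ * p ^ j ≠ τ * p ^ k) : Function.Injective (node p σ τ) := by
  have hpow : Function.Injective fun k : ℕ => p ^ k := fun j k h => by
    have h1 := congrArg norm h
    simp only [norm_pow] at h1
    exact (pow_right_strictAnti₀ (norm_pos_iff.mpr hp0) hp).injective h1
  have hx : ∀ {x : ℂ} (k : ℕ), x ≠ 0 → x * p ^ k ≠ 0 :=
    fun k h => mul_ne_zero h (pow_ne_zero k hp0)
  rintro (_ | j | j) (_ | k | k) h <;> simp only [node] at h
  · rfl
  · exact absurd h.symm (hx k hσ)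
  · exact absurd h.symm (hx k hτ)
  · exact absurd h (hx j hσ)
  · rw [hpow (mul_left_cancel₀ hσ h)]
  · exact absurd h (hτσ j k)
  · exact absurd h (hx j hτ)
  · exact absurd h.symm (hτσ k j)
  · rw [hpow (mul_left_cancel₀ hτ h)]

/-- The residue theorem for the truncated integrand. -/
lemma loopIntegral_truncated (hγ : ContDiff ℝ 1 γ) (hc : γ 0 = γ 1) (hp : ‖p‖ < 1) (hp0 : p ≠ 0)
    (hσ : σ ≠ 0) (hτ : τ ≠ 0) (hμ : μ ≠ 0) (hν : ν ≠ 0) (hμν : μ * ν = p * σ * τ)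
    (hτσ : ∀ j k : ℕ, σ * p ^ j ≠ τ * p ^ k) (h0 : Encircles γ 0)
    (h1 : ∀ k : ℕ, Encircles γ (σ * p ^ k)) (h2 : ∀ k : ℕ, Encircles γ (τ * p ^ k))
    (hE : ∀ R, OuterMero γ R E) (N : ℕ) :
    loopIntegral γ (fun z => E z * (qPoch p (μ / z) N * qPoch p (ν / z) N /
        (qPoch p (σ / z) N * qPoch p (τ / z) N)) * z⁻¹) =
      p ^ N * E 0 +
      ((∑ k ∈ Finset.range N,
        p ^ k * (qPoch p (p * σ / μ) k * qPoch p (p * σ / ν) k /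
            (qPoch p p k * qPoch p (p * σ / τ) k)) *
          (qPoch p (μ / σ) (N - 1 - k + 1) * qPoch p (ν / σ) (N - 1 - k + 1) /
            (qPoch p p (N - 1 - k) * qPoch p (τ / σ) (N - 1 - k + 1))) * E (σ * p ^ k)) +
      ∑ k ∈ Finset.range N,
        p ^ k * (qPoch p (p * τ / μ) k * qPoch p (p * τ / ν) k /
            (qPoch p p k * qPoch p (p * τ / σ) k)) *
          (qPoch p (μ / τ) (N - 1 - k + 1) * qPoch p (ν / τ) (N - 1 - k + 1) /
            (qPoch p p (N - 1 - k) * qPoch p (σ / τ) (N - 1 - k + 1))) * E (τ * p ^ k)) := by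
  obtain ⟨R, hR, hnR⟩ := exists_ball hγ hp σ τ
  set Q : ℂ → ℂ := fun z => (∏ j ∈ Finset.range N, (z - μ * p ^ j)) *
    ∏ j ∈ Finset.range N, (z - ν * p ^ j) with hQ
  have hQd : Differentiable ℂ Q := by
    apply Differentiable.fun_mul
    · exact Differentiable.fun_finsetProd fun j _ => by fun_prop
    · exact Differentiable.fun_finsetProd fun j _ => by fun_prop
  have henc : ∀ i, Encircles γ (node p σ τ i) := by
    rintro (_ | k | k)
    exacts [h0, h1 k, h2 k]
  -- Numerator and denominator each contain 2N factors in 1/z, so the powers of z cancel and only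
  -- the pole from z⁻¹ is left at 0.
  have hcongr : loopIntegral γ (fun z => E z * (qPoch p (μ / z) N * qPoch p (ν / z) N /
        (qPoch p (σ / z) N * qPoch p (τ / z) N)) * z⁻¹) =
      loopIntegral γ (fun z => E z * Q z * ∏ i ∈ nodeSet N, (z - node p σ τ i)⁻¹) := by
    refine loopIntegral_congr fun t ht => ?_
    have hz : γ t ≠ 0 := h0.ne t ht
    have hzN : γ t ^ N ≠ 0 := pow_ne_zero _ hz
    simp only [hQ, prod_nodeSet, node, Finset.prod_inv_distrib, prod_sub_eq_pow_mul_qPoch _ hz,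
      sub_zero]
    generalize qPoch p (μ / γ t) N = a1
    generalize qPoch p (ν / γ t) N = a2
    generalize qPoch p (σ / γ t) N = a3
    generalize qPoch p (τ / γ t) N = a4
    simp only [div_eq_mul_inv, mul_inv]
    field_simp
  rw [hcongr, ((hE R).mul (OuterMero.of_differentiable hQd)).loopIntegral_mul_prod_inv hγ hc hR
    ⟨none, by simp [nodeSet]⟩ (node_injective hp hp0 hσ hτ hτσ).injOn (fun i _ => hnR i)
    (fun i _ => (henc i).ne) (fun i _ => (henc i).winding), sum_nodeSet]
  have hpp := mul_pow_ne_one hp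
  refine congrArg₂ _ ?_ (congrArg₂ _ (Finset.sum_congr rfl fun k hk => ?_)
    (Finset.sum_congr rfl fun k hk => ?_))
  · rw [prod_erase_nodeSet, prod_nodeSet]
    simp only [reduceCtorEq, if_true, if_false, node, hQ, one_mul, zero_sub]
    -- Residue at 0: each j contributes μν/(στ) = p.
    have : ((∏ j ∈ Finset.range N, (-(σ * p ^ j))⁻¹) * ∏ j ∈ Finset.range N, (-(τ * p ^ j))⁻¹) *
        ((∏ j ∈ Finset.range N, -(μ * p ^ j)) * ∏ j ∈ Finset.range N, -(ν * p ^ j)) = p ^ N := by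
      have hpN : p ^ N = ∏ _j ∈ Finset.range N, p := by simp
      rw [hpN, ← Finset.prod_mul_distrib, ← Finset.prod_mul_distrib, ← Finset.prod_mul_distrib]
      refine Finset.prod_congr rfl fun j _ => ?_
      have := pow_ne_zero j hp0
      field_simp
      linear_combination hμν
    linear_combination E 0 * this
  · obtain ⟨m, rfl⟩ : ∃ m, N = k + 1 + m :=
      ⟨N - 1 - k, by have := Finset.mem_range.mp hk; omega⟩
    have hm : k + 1 + m - 1 - k = m := by omega
    rw [hm, ← residue_eq hp0 hσ hτ hμ hν hμν hpp hτσ, prod_erase_nodeSet, prod_nodeSet]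
    simp only [reduceCtorEq, if_false, node, hQ, Option.some.injEq, Sum.inl.injEq, sub_zero]
    ring
  · obtain ⟨m, rfl⟩ : ∃ m, N = k + 1 + m :=
      ⟨N - 1 - k, by have := Finset.mem_range.mp hk; omega⟩
    have hm : k + 1 + m - 1 - k = m := by omega
    rw [hm, ← residue_eq hp0 hτ hσ hμ hν (by rw [hμν]; ring) hpp (fun j k => (hτσ k j).symm),
      prod_erase_nodeSet, prod_nodeSet]
    simp only [reduceCtorEq, if_false, node, hQ, Option.some.injEq, Sum.inr.injEq, sub_zero]
    ring

lemma continuousOn_div_loop (hγ : ContDiff ℝ 1 γ) (h0 : ∀ t ∈ Set.Icc (0 : ℝ) 1, γ t ≠ 0)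
    (x : ℂ) : ContinuousOn (fun t => x / γ t) (Set.Icc 0 1) :=
  continuousOn_const.div hγ.continuous.continuousOn h0

/-- This form makes the reciprocals of the truncated denominators bounded uniformly in N, since the
shifted infinite products on the right are. -/
lemma inv_qPoch_mul_qPoch {a b : ℂ} (hp : ‖p‖ < 1) (ha : ∀ j : ℕ, a * p ^ j ≠ 1)
    (hb : ∀ j : ℕ, b * p ^ j ≠ 1) (N : ℕ) :
    (qPoch p a N * qPoch p b N)⁻¹ = (qPochInf p a * qPochInf p b)⁻¹ *
      (qPochInf p (a * p ^ N) * qPochInf p (b * p ^ N)) := by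
  have h1 := qPochInf_eq_mul hp a N
  have h2 := qPochInf_eq_mul hp b N
  have h3 := qPochInf_ne_zero hp ha
  have h4 := qPochInf_ne_zero hp hb
  have h5 : qPoch p a N ≠ 0 := qPoch_ne_zero fun j _ => ha j
  have h6 : qPoch p b N ≠ 0 := qPoch_ne_zero fun j _ => hb j
  rw [inv_mul_eq_div, inv_eq_one_div, div_eq_div_iff (by positivity) (by positivity), h1, h2]
  ring

/-- The integral over `γ` is the sum of the residues at the poles accumulating at `0`. -/
theorem loopIntegral_eq_residueSum (hγ : ContDiff ℝ 1 γ) (hc : γ 0 = γ 1) (hp : ‖p‖ < 1)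
    (hp0 : p ≠ 0) (hσ : σ ≠ 0) (hτ : τ ≠ 0) (hμ : μ ≠ 0) (hν : ν ≠ 0)
    (hμν : μ * ν = p * σ * τ) (hτσ : ∀ j k : ℕ, σ * p ^ j ≠ τ * p ^ k) (h0 : Encircles γ 0)
    (h1 : ∀ k : ℕ, Encircles γ (σ * p ^ k)) (h2 : ∀ k : ℕ, Encircles γ (τ * p ^ k))
    (hE : ∀ R, OuterMero γ R E) (hE0 : ContinuousAt E 0) :
    loopIntegral γ (fun z => E z * (qPochInf p (μ / z) * qPochInf p (ν / z) /
        (qPochInf p (σ / z) * qPochInf p (τ / z))) * z⁻¹) =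
      residueSum p σ τ μ ν E + residueSum p τ σ μ ν E := by
  obtain ⟨R, hR, -⟩ := exists_ball hγ hp σ τ
  have hσne : ∀ t ∈ Set.Icc (0 : ℝ) 1, ∀ j : ℕ, σ / γ t * p ^ j ≠ 1 := fun t ht j h => by
    have := h0.ne t ht
    refine (h1 j).ne t ht ?_
    field_simp at h
    exact h.symm
  have hτne : ∀ t ∈ Set.Icc (0 : ℝ) 1, ∀ j : ℕ, τ / γ t * p ^ j ≠ 1 := fun t ht j h => by
    have := h0.ne t ht
    refine (h2 j).ne t ht ?_
    field_simp at h
    exact h.symm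
  have hcd := continuousOn_div_loop hγ h0.ne
  have hcI : ∀ x : ℂ, ContinuousOn (fun t => qPochInf p (x / γ t)) (Set.Icc 0 1) := fun x =>
    (differentiable_qPochInf hp).continuous.comp_continuousOn (hcd x)
  have hcF : ∀ (x : ℂ) (N : ℕ), ContinuousOn (fun t => qPoch p (x / γ t) N) (Set.Icc 0 1) :=
    fun x N => continuousOn_finsetProd _ fun j _ =>
      continuousOn_const.sub ((hcd x).mul continuousOn_const)
  have hEc := (hE R).continuousOn hγ hR
  have hinv : ContinuousOn (fun t => (γ t)⁻¹) (Set.Icc 0 1) :=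
    hγ.continuous.continuousOn.inv₀ h0.ne
  have hlim : Tendsto (fun N : ℕ => loopIntegral γ (fun z => E z *
      (qPoch p (μ / z) N * qPoch p (ν / z) N / (qPoch p (σ / z) N * qPoch p (τ / z) N)) * z⁻¹))
      atTop (𝓝 (loopIntegral γ (fun z => E z * (qPochInf p (μ / z) * qPochInf p (ν / z) /
        (qPochInf p (σ / z) * qPochInf p (τ / z))) * z⁻¹))) := by
    refine Tendsto.const_mul _ ?_
    set ex : ℂ → ℝ → ℝ := fun x t => Real.exp (‖x / γ t‖ / (1 - ‖p‖)) with hex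
    have hexc : ∀ x, ContinuousOn (ex x) (Set.Icc 0 1) := fun x =>
      Real.continuous_exp.comp_continuousOn ((hcd x).norm.div_const _)
    -- The truncated numerators and the tails of the denominators are bounded by the exponentials
    -- `ex`. The bound is continuous on [0,1] because the curve avoids 0 and all σ pʲ, τ pʲ.
    refine intervalIntegral.tendsto_integral_filter_of_dominated_convergence
      (fun t => ‖deriv γ t‖ * (‖E (γ t)‖ *
        (‖(qPochInf p (σ / γ t) * qPochInf p (τ / γ t))⁻¹‖ *
          (ex μ t * ex ν t * (ex σ t * ex τ t))) * ‖(γ t)⁻¹‖)) ?_ ?_ ?_ ?_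
    · refine Eventually.of_forall fun N => ?_
      refine ContinuousOn.aestronglyMeasurable ?_ measurableSet_uIoc
      rw [Set.uIoc_of_le zero_le_one]
      refine ContinuousOn.mono ?_ Set.Ioc_subset_Icc_self
      refine (hγ.continuous_deriv le_rfl).continuousOn.mul ((hEc.mul
        (((hcF _ _).mul (hcF _ _)).div ((hcF _ _).mul (hcF _ _)) fun t ht => ?_)).mul hinv)
      exact mul_ne_zero (qPoch_ne_zero fun j _ => hσne t ht j)
        (qPoch_ne_zero fun j _ => hτne t ht j)
    · refine Eventually.of_forall fun N => Eventually.of_forall fun t ht => ?_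
      rw [Set.uIoc_of_le zero_le_one] at ht
      have ht := Set.Ioc_subset_Icc_self ht
      have hpN : ∀ x : ℂ, ‖qPochInf p (x / γ t * p ^ N)‖ ≤ ex x t := fun x => by
        refine (norm_qPochInf_le hp _).trans (Real.exp_le_exp.mpr ?_)
        have : 0 ≤ 1 - ‖p‖ := by linarith
        refine div_le_div_of_nonneg_right ?_ this
        rw [norm_mul, norm_pow]
        exact mul_le_of_le_one_right (norm_nonneg _) (pow_le_one₀ (norm_nonneg p) hp.le)
      have hpF : ∀ x : ℂ, ‖qPoch p (x / γ t) N‖ ≤ ex x t := fun x => norm_qPoch_le hp _ _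
      have hex0 : ∀ x, 0 ≤ ex x t := fun x => (Real.exp_pos _).le
      beta_reduce
      rw [div_eq_mul_inv (qPoch p (μ / γ t) N * _),
        inv_qPoch_mul_qPoch hp (hσne t ht) (hτne t ht)]
      rw [norm_mul, norm_mul, norm_mul, norm_mul, norm_mul, norm_mul, norm_mul]
      refine mul_le_mul_of_nonneg_left (mul_le_mul_of_nonneg_right
        (mul_le_mul_of_nonneg_left ?_ (norm_nonneg _)) (norm_nonneg _)) (norm_nonneg _)
      rw [mul_left_comm]
      refine mul_le_mul_of_nonneg_left ?_ (norm_nonneg _)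
      have hm := fun x y : ℂ => mul_nonneg (hex0 x) (hex0 y)
      exact mul_le_mul (mul_le_mul (hpF μ) (hpF ν) (norm_nonneg _) (hex0 μ))
        (mul_le_mul (hpN σ) (hpN τ) (norm_nonneg _) (hex0 σ)) (by positivity) (hm μ ν)
    · refine ContinuousOn.intervalIntegrable ?_
      rw [Set.uIcc_of_le zero_le_one]
      refine (hγ.continuous_deriv le_rfl).norm.continuousOn.mul ((hEc.norm.mul
        ((((hcI _).mul (hcI _)).inv₀ fun t ht => ?_).norm.mul
          (((hexc _).mul (hexc _)).mul ((hexc _).mul (hexc _))))).mul hinv.norm)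
      exact mul_ne_zero (qPochInf_ne_zero hp (hσne t ht)) (qPochInf_ne_zero hp (hτne t ht))
    · refine Eventually.of_forall fun t ht => ?_
      rw [Set.uIoc_of_le zero_le_one] at ht
      have ht := Set.Ioc_subset_Icc_self ht
      refine Tendsto.const_mul _ (Tendsto.mul_const _ (Tendsto.const_mul _ ?_))
      exact ((tendsto_qPoch hp _).mul (tendsto_qPoch hp _)).div
        ((tendsto_qPoch hp _).mul (tendsto_qPoch hp _))
        (mul_ne_zero (qPochInf_ne_zero hp (hσne t ht)) (qPochInf_ne_zero hp (hτne t ht)))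
  have hlim' := ((tendsto_pow_atTop_nhds_zero_of_norm_lt_one hp).mul_const (E 0)).add
    ((tendsto_sum_residue (μ := μ) (ν := ν) hp hσ hτ hτσ hE0).add
      (tendsto_sum_residue (μ := μ) (ν := ν) hp hτ hσ (fun j k => (hτσ k j).symm) hE0))
  rw [zero_mul, zero_add] at hlim'
  refine tendsto_nhds_unique hlim (hlim'.congr fun N => ?_)
  exact (loopIntegral_truncated hγ hc hp hp0 hσ hτ hμ hν hμν hτσ h0 h1 h2 hE N).symm

end Kernel

/-! ### The residue sums as ₄φ₃ series -/

lemma qTheta_div {p : ℂ} (hp : p ≠ 0) (x : ℂ) : qTheta p (p / x) = qTheta p x := by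
  rw [qTheta, qTheta, div_div_cancel₀ hp, mul_comm]

/-- The residue sums of the integrand of the overlap coefficient are `₄φ₃` series. -/
lemma residueSum_eq_phi43 {p σ τ μ ν K A₁ A₂ B₁ B₂ B₃ B₄ : ℂ} (hp : ‖p‖ < 1) (hp0 : p ≠ 0)
    (hσ : σ ≠ 0) (hμ : μ ≠ 0) (hν : ν ≠ 0)
    (hA₁ : ∀ k : ℕ, A₁ * σ * p ^ k ≠ 1) (hA₂ : ∀ k : ℕ, A₂ * σ * p ^ k ≠ 1)
    (hB₁ : ∀ k : ℕ, B₁ * σ * p ^ k ≠ 1) (hB₂ : ∀ k : ℕ, B₂ * σ * p ^ k ≠ 1)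
    (hB₃ : ∀ k : ℕ, B₃ * σ * p ^ k ≠ 1) (hB₄ : ∀ k : ℕ, B₄ * σ * p ^ k ≠ 1) :
    residueSum p σ τ μ ν (fun z => K * (qPochInf p (A₁ * z) * qPochInf p (A₂ * z) *
        (qPochInf p (p / μ * z) * qPochInf p (p / ν * z))) *
        ((qPochInf p (B₁ * z))⁻¹ * (qPochInf p (B₂ * z))⁻¹ *
        ((qPochInf p (B₃ * z))⁻¹ * (qPochInf p (B₄ * z))⁻¹))) =
      K * (qTheta p (p / μ * σ) * qTheta p (p / ν * σ) * (qPochInf p (A₁ * σ) *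
        qPochInf p (A₂ * σ))) / (qPochInf p p * qPochInf p (τ / σ) *
          (qPochInf p (B₁ * σ) * qPochInf p (B₂ * σ) *
          (qPochInf p (B₃ * σ) * qPochInf p (B₄ * σ)))) *
      phi43 p (B₁ * σ) (B₂ * σ) (B₃ * σ) (B₄ * σ) (A₁ * σ) (A₂ * σ) (p * σ / τ) p := by
  have e : ∀ x : ℂ, x ≠ 0 → p / (p / x * σ) = x / σ := fun x hx => by field_simp
  have e' : ∀ x : ℂ, p * σ / x = p / x * σ := fun x => by ring
  rw [residueSum, phi43, ← tsum_mul_left, ← tsum_mul_left]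
  refine tsum_congr fun k => ?_
  simp only [qTheta, e μ hμ, e ν hν, e' μ, e' ν, ← mul_assoc]
  have hA : ∀ X : ℂ, (∀ k : ℕ, X * σ * p ^ k ≠ 1) →
      qPochInf p (X * σ * p ^ k) = qPochInf p (X * σ) / qPoch p (X * σ) k := fun X hX => by
    rw [qPochInf_eq_mul hp (X * σ) k, mul_div_cancel_left₀ _ (qPoch_ne_zero fun j _ => hX j)]
  -- The numerator factors at pσ/μ and pσ/ν complete the tails inside E to products independent of
  -- k. These leave the series and, with (μ/σ, ν/σ;p)_∞, form the theta functions.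
  have hM : ∀ X : ℂ, qPoch p (p / X * σ) k * qPochInf p (p / X * σ * p ^ k) =
      qPochInf p (p / X * σ) := fun X => (qPochInf_eq_mul hp _ k).symm
  rw [hA A₁ hA₁, hA A₂ hA₂, hA B₁ hB₁, hA B₂ hB₂, hA B₃ hB₃, hA B₄ hB₄, ← hM μ, ← hM ν]
  simp only [div_eq_mul_inv, mul_inv, inv_inv]
  ring

/-- The eigenfunction with the powers of `q` replaced by independent parameters. -/
def eigenfunAux (p q ω e s u x z : ℂ) : ℂ :=
  (qPochPM p (s * (q / ω ^ 2)) x * qPochInf p (u * s * z * (q * ω)) *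
      qTheta p (e / ω * u * z / s)) /
    (qPochPM p (u * z * ω⁻¹) x * qPochInf p (s * (q / ω) / (u * z)))

lemma star_eigenfunAux {p : ℂ} (hp : ‖p‖ < 1) (q ω e s u x z : ℂ) :
    star (eigenfunAux p q ω e s u x z) =
      eigenfunAux (star p) (star q) (star ω) (star e) (star s) (star u) (star x) (star z) := by
  simp only [eigenfunAux, qPochPM, qTheta, star_div₀, star_mul', star_qPochInf hp, star_inv₀,
    star_pow]

/-- Each theta function splits into a factor entire in z, which joins E, and a factor in 1/z, which
supplies μ or ν. The inner poles start at σ = sq/(ωu) and τ = tqω/v. With p = q² one has μν = pστ.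
-/
lemma mul_eigenfunAux {p q ω e s u t v x y z : ℂ} (hs : s ≠ 0) (hu : u ≠ 0) (ht : t ≠ 0)
    (hv : v ≠ 0) (hω : ω ≠ 0) (he : e ≠ 0) (hp : p ≠ 0) (hz : z ≠ 0) :
    eigenfunAux p q ω e s u x z * eigenfunAux p q ω⁻¹ e⁻¹ t v y z / z =
    (qPochPM p (s * q / ω ^ 2) x * qPochPM p (t * q * ω ^ 2) y) *
      (qPochInf p (u * s * q * ω * z) * qPochInf p (v * t * q / ω * z) *
        (qPochInf p (p / (p * (ω * s / (e * u))) * z) *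
          qPochInf p (p / (p * (e * t / (ω * v))) * z))) *
      ((qPochInf p (u * x / ω * z))⁻¹ * (qPochInf p (u / x / ω * z))⁻¹ *
        ((qPochInf p (v * y * ω * z))⁻¹ * (qPochInf p (v / y * ω * z))⁻¹)) *
      (qPochInf p (p * (ω * s / (e * u)) / z) * qPochInf p (p * (e * t / (ω * v)) / z) /
        (qPochInf p (s * q / (ω * u) / z) * qPochInf p (t * q * ω / v / z))) * z⁻¹ := by
  have h1 : s * (q / ω ^ 2) = s * q / ω ^ 2 := by ring
  have h2 : u * s * z * (q * ω) = u * s * q * ω * z := by ring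
  have h3 : e / ω * u * z / s = p / (p * (ω * s / (e * u))) * z := by field_simp
  have h4 : p / (p / (p * (ω * s / (e * u))) * z) = p * (ω * s / (e * u)) / z := by field_simp
  have h5 : u * z * ω⁻¹ * x = u * x / ω * z := by ring
  have h6 : u * z * ω⁻¹ / x = u / x / ω * z := by ring
  have h7 : s * (q / ω) / (u * z) = s * q / (ω * u) / z := by field_simp
  have g1 : t * (q / ω⁻¹ ^ 2) = t * q * ω ^ 2 := by field_simp
  have g2 : v * t * z * (q * ω⁻¹) = v * t * q / ω * z := by ring
  have g3 : e⁻¹ / ω⁻¹ * v * z / t = p / (p * (e * t / (ω * v))) * z := by field_simp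
  have g4 : p / (p / (p * (e * t / (ω * v))) * z) = p * (e * t / (ω * v)) / z := by field_simp
  have g5 : v * z * ω⁻¹⁻¹ * y = v * y * ω * z := by rw [inv_inv]; ring
  have g6 : v * z * ω⁻¹⁻¹ / y = v / y * ω * z := by rw [inv_inv]; ring
  have g7 : t * (q / ω⁻¹) / (v * z) = t * q * ω / v / z := by field_simp
  simp only [eigenfunAux, qTheta]
  rw [h1, h2, h3, h4, h7, g1, g2, g3, g4, g7]
  simp only [qPochPM]
  rw [h5, h6, g5, g6]
  simp only [div_eq_mul_inv, mul_inv]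
  ring

/-! ### Powers of q and complex conjugation -/

section Powers

variable {q : ℝ}

lemma cpow_one_add (hq : 0 < q) (c : ℂ) : (q : ℂ) ^ (1 + c) = q * (q : ℂ) ^ c := by
  rw [cpow_add _ _ (by exact_mod_cast hq.ne'), cpow_one]

lemma norm_cpow_I (hq : 0 < q) (lam : ℝ) : ‖(q : ℂ) ^ (I * lam)‖ = 1 := by
  rw [norm_cpow_eq_rpow_re_of_pos hq]
  simp

lemma cpow_one_sub_two (hq : 0 < q) (lam : ℝ) :
    (q : ℂ) ^ (1 - 2 * I * lam) = q / ((q : ℂ) ^ (I * lam)) ^ 2 := by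
  rw [cpow_sub _ _ (by exact_mod_cast hq.ne'), cpow_one, mul_assoc, ← cpow_nat_mul]
  norm_num

lemma cpow_one_add_two (hq : 0 < q) (lam : ℝ) :
    (q : ℂ) ^ (1 + 2 * I * lam) = q * ((q : ℂ) ^ (I * lam)) ^ 2 := by
  rw [cpow_one_add hq, mul_assoc, ← cpow_nat_mul]
  norm_num

lemma cpow_one_sub (hq : 0 < q) (lam : ℝ) :
    (q : ℂ) ^ (1 - I * lam) = q / (q : ℂ) ^ (I * lam) := by
  rw [cpow_sub _ _ (by exact_mod_cast hq.ne'), cpow_one]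

lemma cpow_neg_I (lam : ℝ) : (q : ℂ) ^ (-I * lam) = ((q : ℂ) ^ (I * lam))⁻¹ := by
  rw [neg_mul, cpow_neg]

lemma cpow_kappa (hq : 0 < q) (lam eps : ℝ) : (q : ℂ) ^ (-1 - 2 * (eps : ℂ) + 2 * I * lam) =
    ((q : ℂ) ^ (I * lam)) ^ 2 / (q * (q : ℂ) ^ (2 * (eps : ℂ))) := by
  have hq0 : (q : ℂ) ≠ 0 := by exact_mod_cast hq.ne'
  rw [show -1 - 2 * (eps : ℂ) + 2 * I * lam = 2 * (I * lam) - (1 + 2 * eps) by ring,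
    cpow_sub _ _ hq0, cpow_one_add hq, ← cpow_nat_mul]
  norm_num

lemma eigenfun_eq_eigenfunAux (hq : 0 < q) (s u t v : ℂ) (lam eps : ℝ) (x z : ℂ) :
    eigenfun q ⟨s, u, t, v, lam, eps⟩ x z =
      eigenfunAux ((q : ℂ) ^ 2) q ((q : ℂ) ^ (I * lam)) ((q : ℂ) ^ (2 * (eps : ℂ))) s u x z := by
  have hq0 : (q : ℂ) ≠ 0 := by exact_mod_cast hq.ne'
  have h4 : (q : ℂ) ^ (2 * (eps : ℂ) - I * lam) =
      (q : ℂ) ^ (2 * (eps : ℂ)) / (q : ℂ) ^ (I * lam) := cpow_sub _ _ hq0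
  simp only [eigenfun, eigenfunAux, cpow_one_sub_two hq, cpow_one_sub hq, cpow_neg_I, h4,
    cpow_one_add hq]

lemma star_cpow_I (hq : 0 < q) (lam : ℝ) :
    star ((q : ℂ) ^ (I * lam)) = ((q : ℂ) ^ (I * lam))⁻¹ := by
  have hq' : (q : ℂ).arg ≠ Real.pi := by
    rw [arg_ofReal_of_nonneg hq.le]
    exact Real.pi_pos.ne
  rw [← cpow_neg]
  have := cpow_conj (q : ℂ) (I * lam) hq'
  rw [conj_ofReal] at this
  simpa using this.symm

lemma star_cpow_ofReal (hq : 0 < q) (eps : ℝ) :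
    star ((q : ℂ) ^ (2 * (eps : ℂ))) = (q : ℂ) ^ (2 * (eps : ℂ)) := by
  have : (q : ℂ) ^ (2 * (eps : ℂ)) = ((q ^ (2 * eps) : ℝ) : ℂ) := by
    rw [ofReal_cpow hq.le]
    push_cast
    rfl
  rw [this]
  exact conj_ofReal _

/-- The two inversions of z cancel and conjugation undoes the bars. It also inverts q^{iλ}, while ϑ
has already changed the sign of ε; so both ω = q^{iλ} and e = q^{2ε} are replaced by their inverses.
-/
lemma starFun_eigenfunThetaBar (hq : 0 < q) (hq1 : q < 1) (s u t v lam eps : ℝ) (y z : ℂ) :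
    starFun (eigenfunThetaBar q ⟨(s : ℂ), (u : ℂ), (t : ℂ), (v : ℂ), lam, eps⟩ (star y)) z =
      eigenfunAux ((q : ℂ) ^ 2) q ((q : ℂ) ^ (I * lam))⁻¹ ((q : ℂ) ^ (2 * (eps : ℂ)))⁻¹ t v y z := by
  have hp : ‖(q : ℂ) ^ 2‖ < 1 := by
    rw [norm_pow, norm_real, Real.norm_of_nonneg hq.le]
    exact pow_lt_one₀ hq.le hq1 two_ne_zero
  have hr : ∀ r : ℝ, star (r : ℂ) = r := conj_ofReal
  simp only [starFun, eigenfunThetaBar, reflect, inv_inv, Params.bar, Params.theta, hr]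
  rw [eigenfun_eq_eigenfunAux hq, star_eigenfunAux hp, star_pow, star_star, star_star,
    star_cpow_I hq, star_cpow_ofReal hq, hr, hr, hr]
  congr 1
  rw [← cpow_neg]
  push_cast
  ring_nf

end Powers

/-! ### The overlap integral in independent parameters -/

/-- Inner and outer poles have different winding numbers and so cannot coincide. Existence of the
contour thus keeps the outer denominators nonzero at the residue points. -/
lemma Encircles.mul_ne_one {γ : ℝ → ℂ} {p σ B : ℂ} (hB : B ≠ 0)
    (hσ : ∀ k : ℕ, Encircles γ (σ * p ^ k)) (hB' : ∀ k : ℕ, Avoids γ (1 / (B * p ^ k)))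
    (k : ℕ) : B * σ * p ^ k ≠ 1 := by
  intro h
  have h1 : σ * p ^ k = 1 / (B * p ^ 0) := by
    rw [pow_zero, mul_one, eq_div_iff hB]
    linear_combination h
  have h2 := (hσ k).winding
  rw [h1, (hB' 0).winding] at h2
  exact zero_ne_one h2

/-- The residues at σ pᵏ give the first term of the Askey–Wilson function and those at τ pᵏ the
second. In the first, (ax^{±1};p)_∞ from K cancels against the denominator; in the second, the
factor of K depending on y does. -/
theorem loopIntegral_mul_eigenfunAux {γ : ℝ → ℂ} (hγ : ContDiff ℝ 1 γ) (hc : γ 0 = γ 1)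
    {p q ω e s u t v x y a b c d κ At bt : ℂ} (hp : ‖p‖ < 1) (hq0 : q ≠ 0) (hpq : p = q ^ 2)
    (hs : s ≠ 0) (hu : u ≠ 0) (ht : t ≠ 0) (hv : v ≠ 0) (hω : ω ≠ 0) (he : e ≠ 0)
    (hx : x ≠ 0) (hy : y ≠ 0)
    (ha : a = s * q / ω ^ 2) (hb : b = s * q * ω ^ 2) (hc' : c = t * v * q / u)
    (hd : d = q * v / (u * t)) (hκ : κ = ω ^ 2 / (q * e)) (hAt : At = s * v * q / u)
    (hbt : bt = t * q * ω ^ 2)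
    (had : ∀ k : ℤ, a * d ≠ p ^ k)
    (hab : ∀ k : ℕ, a * b * p ^ k ≠ 1) (hac : ∀ k : ℕ, a * c * p ^ k ≠ 1)
    (hbd : ∀ k : ℕ, p * b / d * p ^ k ≠ 1) (hcd : ∀ k : ℕ, p * c / d * p ^ k ≠ 1)
    (h0 : Encircles γ 0) (h1 : ∀ k : ℕ, Encircles γ (s * q / (ω * u) * p ^ k))
    (h2 : ∀ k : ℕ, Encircles γ (t * q * ω / v * p ^ k))
    (hB₁ : ∀ k : ℕ, Avoids γ (1 / (u * x / ω * p ^ k)))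
    (hB₂ : ∀ k : ℕ, Avoids γ (1 / (u / x / ω * p ^ k)))
    (hB₃ : ∀ k : ℕ, Avoids γ (1 / (v * y * ω * p ^ k)))
    (hB₄ : ∀ k : ℕ, Avoids γ (1 / (v / y * ω * p ^ k))) :
    loopIntegral γ (fun z => eigenfunAux p q ω e s u x z * eigenfunAux p q ω⁻¹ e⁻¹ t v y z / z) =
      qPochPM p bt y * (qTheta p (1 / κ) * qTheta p (a * d * κ)) /
        (qPochInf p p * qPochPM p At y) * askeyWilson p At a b c d y x := by
  have hp0 : p ≠ 0 := hpq ▸ pow_ne_zero 2 hq0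
  set σ := s * q / (ω * u) with hσdef
  set τ := t * q * ω / v with hτdef
  set μ := p * (ω * s / (e * u)) with hμdef
  set ν := p * (e * t / (ω * v)) with hνdef
  have hσ : σ ≠ 0 := by positivity
  have hτ : τ ≠ 0 := by positivity
  have hμ : μ ≠ 0 := by positivity
  have hν : ν ≠ 0 := by positivity
  have hμν : μ * ν = p * σ * τ := by
    rw [hμdef, hνdef, hσdef, hτdef, hpq]
    field_simp
  have hadστ : p * σ / τ = a * d := by
    rw [hσdef, hτdef, ha, hd, hpq]
    field_simp
  have hτσ : ∀ j k : ℕ, σ * p ^ j ≠ τ * p ^ k := by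
    intro j k h
    refine had (1 + k - j) ?_
    rw [← hadστ, zpow_sub₀ hp0, zpow_add₀ hp0, zpow_one, zpow_natCast, zpow_natCast,
      div_eq_div_iff hτ (pow_ne_zero _ hp0)]
    linear_combination p * h
  have n₁ : u * x / ω ≠ 0 := by positivity
  have n₂ : u / x / ω ≠ 0 := by positivity
  have n₃ : v * y * ω ≠ 0 := by positivity
  have n₄ : v / y * ω ≠ 0 := by positivity
  set K := qPochPM p (s * q / ω ^ 2) x * qPochPM p (t * q * ω ^ 2) y with hK
  set E : ℂ → ℂ := fun z => K * (qPochInf p (u * s * q * ω * z) * qPochInf p (v * t * q / ω * z) *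
        (qPochInf p (p / μ * z) * qPochInf p (p / ν * z))) *
      ((qPochInf p (u * x / ω * z))⁻¹ * (qPochInf p (u / x / ω * z))⁻¹ *
        ((qPochInf p (v * y * ω * z))⁻¹ * (qPochInf p (v / y * ω * z))⁻¹)) with hEdef
  have hent : ∀ X : ℂ, Differentiable ℂ fun z => qPochInf p (X * z) := fun X =>
    (differentiable_qPochInf hp).comp (by fun_prop)
  have hEo : ∀ R, OuterMero γ R E := fun R =>
    (OuterMero.of_differentiable (((hent _).mul (hent _)).mul
      ((hent _).mul (hent _)) |>.const_mul K)).mul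
      (((OuterMero.inv_qPochInf hp hp0 n₁ hB₁).mul (OuterMero.inv_qPochInf hp hp0 n₂ hB₂)).mul
      ((OuterMero.inv_qPochInf hp hp0 n₃ hB₃).mul (OuterMero.inv_qPochInf hp hp0 n₄ hB₄)))
  have hEc : ContinuousAt E 0 := by
    have hi : ∀ X : ℂ, ContinuousAt (fun z => (qPochInf p (X * z))⁻¹) 0 := fun X =>
      (hent X).continuous.continuousAt.inv₀ (qPochInf_ne_zero hp fun j => by simp)
    exact ((((hent _).mul (hent _)).mul ((hent _).mul (hent _)) |>.const_mul K).continuous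
      |>.continuousAt).mul (((hi _).mul (hi _)).mul ((hi _).mul (hi _)))
  have hint : loopIntegral γ (fun z => eigenfunAux p q ω e s u x z *
      eigenfunAux p q ω⁻¹ e⁻¹ t v y z / z) =
      residueSum p σ τ μ ν E + residueSum p τ σ μ ν E := by
    rw [← loopIntegral_eq_residueSum hγ hc hp hp0 hσ hτ hμ hν hμν hτσ h0 h1 h2 hEo hEc]
    exact loopIntegral_congr fun r hr => mul_eigenfunAux hs hu ht hv hω he hp0 (h0.ne r hr)
  have a₁ : u * s * q * ω * σ = a * b := by
    rw [hσdef, ha, hb]; field_simp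
  have a₂ : v * t * q / ω * σ = a * c := by
    rw [hσdef, ha, hc']; field_simp
  have a₃ : u * s * q * ω * τ = p * b / d := by
    rw [hτdef, hd, hb, hpq]; field_simp
  have a₄ : v * t * q / ω * τ = p * c / d := by
    rw [hτdef, hd, hc', hpq]; field_simp
  have b₁ : u * x / ω * σ = a * x := by
    rw [hσdef, ha]; field_simp
  have b₂ : u / x / ω * σ = a / x := by
    rw [hσdef, ha]; field_simp
  have b₃ : v * y * ω * σ = At * y := by
    rw [hσdef, hAt]; field_simp
  have b₄ : v / y * ω * σ = At / y := by
    rw [hσdef, hAt]; field_simp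
  have c₁ : u * x / ω * τ = p / d * x := by
    rw [hτdef, hd, hpq]; field_simp
  have c₂ : u / x / ω * τ = p / d / x := by
    rw [hτdef, hd, hpq]; field_simp
  have c₃ : v * y * ω * τ = bt * y := by
    rw [hτdef, hbt]; field_simp
  have c₄ : v / y * ω * τ = bt / y := by
    rw [hτdef, hbt]; field_simp
  have t₁ : p / μ * σ = 1 / κ := by
    rw [hμdef, hσdef, hκ]; field_simp
  have t₂ : p / ν * σ = a * d * κ := by
    rw [hνdef, hσdef, hκ, ha, hd]; field_simp
  have t₃ : p / μ * τ = p / (a * d * κ) := by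
    rw [hμdef, hτdef, hκ, ha, hd, hpq]; field_simp
  have t₄ : p / ν * τ = p / (1 / κ) := by
    rw [hνdef, hτdef, hκ, hpq]; field_simp
  have r₁ : τ / σ = p / (a * d) := by
    rw [← hadστ]; field_simp
  have r₂ : σ / τ = a * d / p := by
    rw [← hadστ]; field_simp
  have r₃ : p * τ / σ = p ^ 2 / (a * d) := by
    rw [← hadστ]; field_simp
  -- The dual parameter d̃ = ad/ã equals p/bᶿ, where bᶿ is `bt`.
  have hdb : a * d / At = p / bt := by
    rw [ha, hd, hAt, hbt, hpq]; field_simp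
  have hbt0 : bt ≠ 0 := by rw [hbt]; positivity
  have d₁ : p / (p / bt) = bt := div_div_cancel₀ hp0
  have d₂ : p * y / (p / bt) = bt * y := by field_simp
  have d₃ : p / (p / bt * y) = bt / y := by field_simp
  have d₄ : p * x / d = p / d * x := by ring
  have d₅ : p / (d * x) = p / d / x := by rw [div_div]
  have e₁ := Encircles.mul_ne_one n₁ h1 hB₁
  have e₂ := Encircles.mul_ne_one n₂ h1 hB₂
  have e₃ := Encircles.mul_ne_one n₃ h1 hB₃
  have e₄ := Encircles.mul_ne_one n₄ h1 hB₄
  have f₁ := Encircles.mul_ne_one n₁ h2 hB₁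
  have f₂ := Encircles.mul_ne_one n₂ h2 hB₂
  have f₃ := Encircles.mul_ne_one n₃ h2 hB₃
  have f₄ := Encircles.mul_ne_one n₄ h2 hB₄
  rw [hint, hEdef,
    residueSum_eq_phi43 hp hp0 hσ hμ hν (by rwa [a₁]) (by rwa [a₂]) e₁ e₂ e₃ e₄,
    residueSum_eq_phi43 hp hp0 hτ hμ hν (by rwa [a₃]) (by rwa [a₄]) f₁ f₂ f₃ f₄]
  rw [b₁] at e₁
  rw [b₂] at e₂
  rw [b₃] at e₃
  rw [b₄] at e₄
  rw [c₃] at f₃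
  rw [c₄] at f₄
  rw [a₁, a₂, a₃, a₄, b₁, b₂, b₃, b₄, c₁, c₂, c₃, c₄, t₁, t₂, t₃, t₄, r₁, r₂, r₃, hadστ,
    qTheta_div hp0, qTheta_div hp0, hK, ← ha, ← hbt, askeyWilson, hdb, d₁, d₂, d₃, d₄, d₅]
  simp only [qPochPM]
  -- Only these six products cancel, so only they must be nonzero; the other denominators match as
  -- formal inverses.
  have g₁ := qPochInf_ne_zero hp e₁
  have g₂ := qPochInf_ne_zero hp e₂
  have g₃ := qPochInf_ne_zero hp e₃
  have g₄ := qPochInf_ne_zero hp e₄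
  have g₅ := qPochInf_ne_zero hp f₃
  have g₆ := qPochInf_ne_zero hp f₄
  generalize phi43 p (a * x) _ _ _ _ _ _ _ = φ₁
  generalize phi43 p (p / d * x) _ _ _ _ _ _ _ = φ₂
  generalize qPochInf p (a * x) = X₁ at *
  generalize qPochInf p (a / x) = X₂ at *
  generalize qPochInf p (At * y) = X₃ at *
  generalize qPochInf p (At / y) = X₄ at *
  generalize qPochInf p (bt * y) = X₅ at *
  generalize qPochInf p (bt / y) = X₆ at *
  simp only [div_eq_mul_inv, mul_inv]
  generalize (qPochInf p p)⁻¹ = V₁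
  generalize (qPochInf p (p * (a * d)⁻¹))⁻¹ = V₂
  generalize (qPochInf p (a * d * p⁻¹))⁻¹ = V₃
  generalize (qPochInf p (p * d⁻¹ * x))⁻¹ = V₄
  generalize (qPochInf p (p * d⁻¹ * x⁻¹))⁻¹ = V₅
  field_simp

/-! ### The unit circle -/

/-- The positively oriented unit circle, parametrized by `[0,1]`. -/
def unitLoop (r : ℝ) : ℂ := circleMap 0 1 (2 * Real.pi * r)

lemma deriv_unitLoop (r : ℝ) :
    deriv unitLoop r = 2 * Real.pi * deriv (circleMap 0 1) (2 * Real.pi * r) := by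
  have h1 : HasDerivAt (fun r : ℝ => 2 * Real.pi * r) (2 * Real.pi) r := by
    simpa using (hasDerivAt_id r).const_mul (2 * Real.pi)
  have := (hasDerivAt_circleMap 0 1 (2 * Real.pi * r)).scomp r h1
  rw [(hasDerivAt_circleMap 0 1 _).deriv]
  refine (this.deriv : deriv unitLoop r = _).trans ?_
  rw [real_smul]
  push_cast
  rfl

lemma loopIntegral_unitLoop (F : ℂ → ℂ) :
    loopIntegral unitLoop F = (2 * Real.pi * I)⁻¹ * ∮ z in C(0, 1), F z := by
  unfold loopIntegral
  congr 1
  have h := intervalIntegral.smul_integral_comp_mul_left (a := 0) (b := 1)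
    (fun θ => deriv (circleMap 0 1) θ • F (circleMap 0 1 θ)) (2 * Real.pi)
  rw [mul_zero, mul_one] at h
  rw [circleIntegral, ← h, ← intervalIntegral.integral_smul]
  refine intervalIntegral.integral_congr fun r _ => ?_
  simp only [deriv_unitLoop, unitLoop, real_smul, smul_eq_mul]
  push_cast
  ring

lemma norm_unitLoop (r : ℝ) : ‖unitLoop r‖ = 1 := by
  simp [unitLoop]

lemma unitLoop_ne {w : ℂ} (hw : ‖w‖ ≠ 1) (r : ℝ) : unitLoop r ≠ w := fun h =>
  hw (h ▸ norm_unitLoop r)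

lemma winding_unitLoop_of_norm_lt {w : ℂ} (hw : ‖w‖ < 1) : winding unitLoop w = 1 := by
  rw [winding, loopIntegral_unitLoop,
    circleIntegral.integral_sub_inv_of_mem_ball (by simpa using hw)]
  exact inv_mul_cancel₀ two_pi_I_ne_zero

lemma winding_unitLoop_of_lt_norm {w : ℂ} (hw : 1 < ‖w‖) : winding unitLoop w = 0 := by
  have hne : ∀ z ∈ Metric.closedBall (0 : ℂ) 1, z - w ≠ 0 := fun z hz h => by
    rw [sub_eq_zero.mp h, mem_closedBall_zero_iff] at hz
    linarith
  have hd : DifferentiableOn ℂ (fun z => (z - w)⁻¹) (Metric.closedBall 0 1) :=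
    (differentiableOn_id.sub_const w).inv hne
  rw [winding, loopIntegral_unitLoop, circleIntegral_eq_zero_of_differentiable_on_off_countable
    zero_le_one Set.countable_empty hd.continuousOn, mul_zero]
  intro z hz
  refine (hd.mono Metric.ball_subset_closedBall).differentiableAt (Metric.isOpen_ball.mem_nhds ?_)
  exact hz.1

lemma isContour_unitLoop {q : ℝ} {α : Params} {x y : ℂ}
    (hi : ∀ w ∈ innerPoles q α, ‖w‖ < 1) (ho : ∀ w ∈ outerPoles q α x y, 1 < ‖w‖) :
    IsContour q α x y unitLoop where
  contDiff := (contDiff_circleMap 0 1).comp (by fun_prop)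
  closed := by
    simp [unitLoop, circleMap]
  ne_zero := fun r _ => unitLoop_ne (by simp) r
  winding_zero := winding_unitLoop_of_norm_lt (by simp)
  inner_ne := fun w hw r _ => unitLoop_ne (hi w hw).ne r
  winding_inner := fun w hw => winding_unitLoop_of_norm_lt (hi w hw)
  outer_ne := fun w hw r _ => unitLoop_ne (ho w hw).ne' r
  winding_outer := fun w hw => winding_unitLoop_of_lt_norm (ho w hw)

lemma overlap_eq_overlapAlong (q : ℝ) (α : Params) (x y : ℂ) :
    overlap q α x y = overlapAlong q α unitLoop x y := by
  rw [overlapAlong, loopIntegral_unitLoop, overlap, innerT]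

/-! ### Specialization to the parameters of the theorem -/

section Parameters

variable {q s u t v lam eps : ℝ} {x y : ℂ}

theorem overlapAlong_eq (hq0 : 0 < q) (hq1 : q < 1) (hs : s ≠ 0) (hu : u ≠ 0) (ht : t ≠ 0)
    (hv : v ≠ 0) (hx : x ≠ 0) (hy : y ≠ 0) {α : Params} (hα : α = ⟨s, u, t, v, lam, eps⟩)
    (had : ∀ k : ℤ, parA q α * parD q α ≠ (q : ℂ) ^ (2 * k))
    (h : ∀ n : ℕ, parA q α * parB q α * (q : ℂ) ^ (2 * n) ≠ 1 ∧
      parA q α * parC q α * (q : ℂ) ^ (2 * n) ≠ 1 ∧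
      (q : ℂ) ^ 2 * parB q α / parD q α * (q : ℂ) ^ (2 * n) ≠ 1 ∧
      (q : ℂ) ^ 2 * parC q α / parD q α * (q : ℂ) ^ (2 * n) ≠ 1)
    {γ : ℝ → ℂ} (hγ : IsContour q α x y γ) :
    overlapAlong q α γ x y = prefactor q α y *
      askeyWilson ((q : ℂ) ^ 2) ((q : ℂ) ^ 2 / parD q α.theta)
        (parA q α) (parB q α) (parC q α) (parD q α) y x := by
  have hqc : (q : ℂ) ≠ 0 := by exact_mod_cast hq0.ne'
  have hsc : (s : ℂ) ≠ 0 := by exact_mod_cast hs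
  have huc : (u : ℂ) ≠ 0 := by exact_mod_cast hu
  have htc : (t : ℂ) ≠ 0 := by exact_mod_cast ht
  have hvc : (v : ℂ) ≠ 0 := by exact_mod_cast hv
  have hω : (q : ℂ) ^ (I * lam) ≠ 0 := by simp [cpow_eq_zero_iff, hqc]
  have he : (q : ℂ) ^ (2 * (eps : ℂ)) ≠ 0 := by simp [cpow_eq_zero_iff, hqc]
  have hp : ‖(q : ℂ) ^ 2‖ < 1 := by
    rw [norm_pow, norm_real, Real.norm_of_nonneg hq0.le]
    exact pow_lt_one₀ hq0.le hq1 two_ne_zero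
  have hpow : ∀ k : ℕ, ((q : ℂ) ^ 2) ^ k = (q : ℂ) ^ (2 * k) := fun k => (pow_mul _ 2 k).symm
  have hin : ∀ w ∈ innerPoles q α, Encircles γ w := fun w hw =>
    ⟨hγ.inner_ne w hw, hγ.winding_inner w hw⟩
  have hout : ∀ w ∈ outerPoles q α x y, Avoids γ w := fun w hw =>
    ⟨hγ.outer_ne w hw, hγ.winding_outer w hw⟩
  subst hα
  simp only [overlapAlong, starFun_eigenfunThetaBar hq0 hq1, eigenfun_eq_eigenfunAux hq0]
  rw [prefactor]
  -- The factor with coefficient ux vanishes at the poles containing 1/x, and conversely, likewise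
  -- for v and y; hence the crossed choice of outer families.
  refine loopIntegral_mul_eigenfunAux hγ.contDiff hγ.closed hp hqc rfl hsc huc htc hvc hω he hx hy
    ?_ ?_ rfl rfl ?_ ?_ ?_ ?_ (fun k => ?_) (fun k => ?_) (fun k => ?_) (fun k => ?_)
    ⟨hγ.ne_zero, hγ.winding_zero⟩ (fun k => hin _ ⟨k, Or.inl ?_⟩) (fun k => hin _ ⟨k, Or.inr ?_⟩)
    (fun k => hout _ ⟨k, Or.inr (Or.inl ?_)⟩) (fun k => hout _ ⟨k, Or.inl ?_⟩)
    (fun k => hout _ ⟨k, Or.inr (Or.inr (Or.inr ?_))⟩)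
    (fun k => hout _ ⟨k, Or.inr (Or.inr (Or.inl ?_))⟩)
  · simp only [parA, cpow_one_sub_two hq0, mul_div_assoc]
  · simp only [parB, cpow_one_add_two hq0]
    ring
  · simp only [parKappa, cpow_kappa hq0]
  · simp only [parD, Params.theta]
    field_simp
  · simp only [parB, Params.theta, cpow_one_add_two hq0]
    ring
  · intro k
    rw [show ((q : ℂ) ^ 2) ^ k = (q : ℂ) ^ (2 * k) by rw [zpow_mul]; rfl]
    exact had k
  · rw [hpow]; exact (h k).1
  · rw [hpow]; exact (h k).2.1
  · rw [hpow]; exact (h k).2.2.1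
  · rw [hpow]; exact (h k).2.2.2
  · simp only [cpow_one_sub hq0, hpow]
    field_simp
  · simp only [cpow_one_add hq0, hpow, mul_assoc]
  · rw [hpow]
    field_simp
  · rw [hpow]
    field_simp
  · simp only [hpow, cpow_neg_I]
    field_simp
  · simp only [hpow, cpow_neg_I]
    field_simp

lemma norm_lt_one_of_norm_mul_div {q : ℝ} {u x : ℂ} (hq0 : 0 < q) (hq1 : q < 1) (hx : x ≠ 0)
    (h1 : ‖u * x‖ ≤ q ^ 2) (h2 : ‖u / x‖ ≤ q ^ 2) : ‖u‖ < 1 := by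
  have h3 : ‖u‖ ^ 2 = ‖u * x‖ * ‖u / x‖ := by
    rw [← norm_mul, ← norm_pow]
    congr 1
    field_simp
  have hq2 : q ^ 2 < 1 := pow_lt_one₀ hq0.le hq1 two_ne_zero
  have h4 : ‖u‖ ^ 2 < 1 := by
    rw [h3]
    exact mul_lt_one_of_nonneg_of_lt_one_left (norm_nonneg _) (h1.trans_lt hq2)
      (h2.trans hq2.le)
  exact (sq_lt_one_iff₀ (norm_nonneg u)).mp h4

lemma mul_pow_ne_one_of_norm_lt {q : ℝ} {w : ℂ} (hq0 : 0 < q) (hq1 : q < 1) (hw : ‖w‖ < 1)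
    (n : ℕ) : w * (q : ℂ) ^ n ≠ 1 := by
  intro h
  have h1 := congrArg norm h
  rw [norm_mul, norm_pow, norm_real, Real.norm_of_nonneg hq0.le, norm_one] at h1
  have := mul_le_of_le_one_right (norm_nonneg w) (pow_le_one₀ hq0.le hq1.le (n := n))
  linarith

lemma one_lt_norm_div_pow {q : ℝ} {w : ℂ} (hq0 : 0 < q) (hq1 : q < 1) (hw : 1 < ‖w‖)
    (n : ℕ) : 1 < ‖w / (q : ℂ) ^ n‖ := by
  rw [norm_div, norm_pow, norm_real, Real.norm_of_nonneg hq0.le, lt_div_iff₀ (pow_pos hq0 n),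
    one_mul]
  exact (pow_le_one₀ hq0.le hq1.le).trans_lt hw

/-- The inner poles have modulus at most q · q < 1, the outer ones at least q⁻² > 1, so the unit
circle separates them. -/
theorem isContour_of_overlapCond (hq0 : 0 < q) (hq1 : q < 1) {α : Params}
    (h : OverlapCond q α x y) : IsContour q α x y unitLoop := by
  obtain ⟨⟨hux, hux'⟩, ⟨hu, hu'⟩, ⟨hvy, hvy'⟩, ⟨hv, hv'⟩, ⟨-, hsu⟩, ⟨-, htv⟩⟩ := h
  have hq2 : q ^ 2 < 1 := pow_lt_one₀ hq0.le hq1 two_ne_zero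
  have hω := norm_cpow_I hq0 α.lam
  have hin : ∀ (w : ℂ) (k : ℕ), ‖w‖ < 1 → ‖w * (q : ℂ) ^ (2 * k)‖ < 1 := fun w k hw => by
    rw [norm_mul, norm_pow, norm_real, Real.norm_of_nonneg hq0.le]
    exact (mul_le_of_le_one_right (norm_nonneg w) (pow_le_one₀ hq0.le hq1.le)).trans_lt hw
  have hinv : ∀ w : ℂ, 0 < ‖w‖ → ‖w‖ ≤ q ^ 2 → 1 < ‖w⁻¹‖ := fun w h1 h2 => by
    rw [norm_inv]
    exact (one_lt_inv₀ h1).mpr (h2.trans_lt hq2)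
  refine isContour_unitLoop ?_ ?_
  · rintro w ⟨k, rfl | rfl⟩ <;> refine hin _ k ?_
    · rw [cpow_one_sub hq0, mul_div_right_comm, norm_mul, norm_div (q : ℂ), hω, div_one,
        norm_real, Real.norm_of_nonneg hq0.le]
      nlinarith [norm_nonneg (α.s / α.u)]
    · rw [cpow_one_add hq0, mul_div_right_comm, norm_mul, norm_mul (q : ℂ), hω, mul_one,
        norm_real, Real.norm_of_nonneg hq0.le]
      nlinarith [norm_nonneg (α.t / α.v)]
  · rintro w ⟨k, rfl | rfl | rfl | rfl⟩ <;> refine one_lt_norm_div_pow hq0 hq1 ?_ _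
    · rw [mul_div_assoc, norm_mul, hω, one_mul, ← inv_div]
      exact hinv _ hu hu'
    · rw [norm_div, hω, one_div, ← norm_inv]
      exact hinv _ hux hux'
    · rw [mul_div_assoc, norm_mul, cpow_neg_I, norm_inv, hω, inv_one, one_mul, ← inv_div]
      exact hinv _ hv hv'
    · rw [norm_div, cpow_neg_I, norm_inv, hω, inv_one, one_div, ← norm_inv]
      exact hinv _ hvy hvy'

/-- Since |u|² = |ux||u/x| < 1 and |s| = |s/u||u|, all of s, u, t, v have modulus less than 1. The
four quantities are s²q², (s/u)tvq², (t/v)suq² and t²q² up to unimodular factors, hence lie in the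
open unit disc. -/
lemma lower_ne_of_overlapCond (hq0 : 0 < q) (hq1 : q < 1) (hx : x ≠ 0) (hy : y ≠ 0)
    {α : Params} (h : OverlapCond q α x y) (n : ℕ) :
    parA q α * parB q α * (q : ℂ) ^ (2 * n) ≠ 1 ∧
      parA q α * parC q α * (q : ℂ) ^ (2 * n) ≠ 1 ∧
      (q : ℂ) ^ 2 * parB q α / parD q α * (q : ℂ) ^ (2 * n) ≠ 1 ∧
      (q : ℂ) ^ 2 * parC q α / parD q α * (q : ℂ) ^ (2 * n) ≠ 1 := by
  obtain ⟨⟨-, hux⟩, ⟨hu0, hux'⟩, ⟨-, hvy⟩, ⟨hv0, hvy'⟩, ⟨hs0, hsu⟩, ⟨ht0, htv⟩⟩ := h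
  have hqn : ‖(q : ℂ)‖ = q := by rw [norm_real, Real.norm_of_nonneg hq0.le]
  have hqc : (q : ℂ) ≠ 0 := by exact_mod_cast hq0.ne'
  have hω := norm_cpow_I hq0 α.lam
  have hω0 : (q : ℂ) ^ (I * α.lam) ≠ 0 := norm_ne_zero_iff.mp (by rw [hω]; exact one_ne_zero)
  have hu1 := norm_lt_one_of_norm_mul_div hq0 hq1 hx hux hux'
  have hv1 := norm_lt_one_of_norm_mul_div hq0 hq1 hy hvy hvy'
  have hs : α.s ≠ 0 := (div_ne_zero_iff.mp (norm_pos_iff.mp hs0)).1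
  have hu : α.u ≠ 0 := (div_ne_zero_iff.mp (norm_pos_iff.mp hs0)).2
  have ht : α.t ≠ 0 := (div_ne_zero_iff.mp (norm_pos_iff.mp ht0)).1
  have hv : α.v ≠ 0 := (div_ne_zero_iff.mp (norm_pos_iff.mp ht0)).2
  have hsu1 : ‖α.s / α.u‖ < 1 := hsu.trans_lt hq1
  have htv1 : ‖α.t / α.v‖ < 1 := htv.trans_lt hq1
  have mul_lt : ∀ {a b : ℂ}, ‖a‖ < 1 → ‖b‖ < 1 → ‖a * b‖ < 1 := fun {a b} ha hb => by
    rw [norm_mul]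
    exact mul_lt_one_of_nonneg_of_lt_one_left (norm_nonneg a) ha hb.le
  have hq' : ‖(q : ℂ)‖ < 1 := hqn.trans_lt hq1
  have hs1 : ‖α.s‖ < 1 := by
    rw [← div_mul_cancel₀ α.s hu]
    exact mul_lt hsu1 hu1
  have ht1 : ‖α.t‖ < 1 := by
    rw [← div_mul_cancel₀ α.t hv]
    exact mul_lt htv1 hv1
  have hωi : ‖((q : ℂ) ^ (I * α.lam))⁻¹ ^ 2‖ = 1 := by rw [norm_pow, norm_inv, hω]; norm_num
  have hω2 : ‖((q : ℂ) ^ (I * α.lam)) ^ 2‖ = 1 := by rw [norm_pow, hω]; norm_num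
  refine ⟨mul_pow_ne_one_of_norm_lt hq0 hq1 ?_ _, mul_pow_ne_one_of_norm_lt hq0 hq1 ?_ _,
    mul_pow_ne_one_of_norm_lt hq0 hq1 ?_ _, mul_pow_ne_one_of_norm_lt hq0 hq1 ?_ _⟩
  · have : parA q α * parB q α = α.s * q * (α.s * q) := by
      simp only [parA, parB, cpow_one_sub_two hq0, cpow_one_add_two hq0]
      field_simp
    rw [this]
    exact mul_lt (mul_lt hs1 hq') (mul_lt hs1 hq')
  · have : parA q α * parC q α =
        α.s / α.u * q * (α.t * (α.v * q)) * ((q : ℂ) ^ (I * α.lam))⁻¹ ^ 2 := by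
      simp only [parA, parC, cpow_one_sub_two hq0]
      field_simp
    rw [this, norm_mul, hωi, mul_one]
    exact mul_lt (mul_lt hsu1 hq') (mul_lt ht1 (mul_lt hv1 hq'))
  · have : (q : ℂ) ^ 2 * parB q α / parD q α =
        α.t / α.v * q * (α.s * (α.u * q)) * ((q : ℂ) ^ (I * α.lam)) ^ 2 := by
      simp only [parB, parD, cpow_one_add_two hq0]
      field_simp
    rw [this, norm_mul, hω2, mul_one]
    exact mul_lt (mul_lt htv1 hq') (mul_lt hs1 (mul_lt hu1 hq'))
  · have : (q : ℂ) ^ 2 * parC q α / parD q α = α.t * q * (α.t * q) := by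
      simp only [parC, parD]
      field_simp
    rw [this]
    exact mul_lt (mul_lt ht1 hq') (mul_lt ht1 hq')

end Parameters

end AWOverlap

end

theorem mainTheorem2 (q : ℝ) (hq0 : 0 < q) (hq1 : q < 1)
    (s u t v lam eps : ℝ) (hs : s ≠ 0) (hu : u ≠ 0) (ht : t ≠ 0) (hv : v ≠ 0)
    (x y : ℂ) (hx : x ≠ 0) (hy : y ≠ 0)
    (α : AWOverlap.Params) (hα : α = ⟨(s : ℂ), (u : ℂ), (t : ℂ), (v : ℂ), lam, eps⟩)
    (a b c d : ℂ) (ha : a = AWOverlap.parA q α) (hb : b = AWOverlap.parB q α)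
    (hc : c = AWOverlap.parC q α) (hd : d = AWOverlap.parD q α)
    (had : ∀ k : ℤ, a * d ≠ (q : ℂ) ^ (2 * k)) :
    ((q : ℂ) ^ 2 / AWOverlap.parD q α.theta) ^ 2 = a * b * c * d / (q : ℂ) ^ 2 ∧
    (AWOverlap.OverlapCond q α x y →
      AWOverlap.overlap q α x y =
        AWOverlap.prefactor q α y *
          AWOverlap.askeyWilson ((q : ℂ) ^ 2) ((q : ℂ) ^ 2 / AWOverlap.parD q α.theta)
            a b c d y x) ∧
    ((∀ n : ℕ, a * b * (q : ℂ) ^ (2 * n) ≠ 1 ∧ a * c * (q : ℂ) ^ (2 * n) ≠ 1 ∧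
        (q : ℂ) ^ 2 * b / d * (q : ℂ) ^ (2 * n) ≠ 1 ∧
        (q : ℂ) ^ 2 * c / d * (q : ℂ) ^ (2 * n) ≠ 1) →
      ∀ γ : ℝ → ℂ, AWOverlap.IsContour q α x y γ →
        AWOverlap.overlapAlong q α γ x y =
          AWOverlap.prefactor q α y *
            AWOverlap.askeyWilson ((q : ℂ) ^ 2) ((q : ℂ) ^ 2 / AWOverlap.parD q α.theta)
              a b c d y x) := by
  subst ha hb hc hd
  refine ⟨?_, fun h => ?_, fun h γ hγ =>
    AWOverlap.overlapAlong_eq hq0 hq1 hs hu ht hv hx hy hα had h hγ⟩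
  · have hqc : (q : ℂ) ≠ 0 := by exact_mod_cast hq0.ne'
    have hω : (q : ℂ) ^ (Complex.I * lam) ≠ 0 := by simp [Complex.cpow_eq_zero_iff, hqc]
    have hsc : (s : ℂ) ≠ 0 := by exact_mod_cast hs
    have huc : (u : ℂ) ≠ 0 := by exact_mod_cast hu
    have htc : (t : ℂ) ≠ 0 := by exact_mod_cast ht
    have hvc : (v : ℂ) ≠ 0 := by exact_mod_cast hv
    subst hα
    -- Both sides equal (svq/u)²; the powers q^{±2iλ} cancel in ab.
    simp only [AWOverlap.parA, AWOverlap.parB, AWOverlap.parC, AWOverlap.parD,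
      AWOverlap.Params.theta, AWOverlap.cpow_one_sub_two hq0, AWOverlap.cpow_one_add_two hq0]
    field_simp
  · rw [AWOverlap.overlap_eq_overlapAlong]
    exact AWOverlap.overlapAlong_eq hq0 hq1 hs hu ht hv hx hy hα had
      (AWOverlap.lower_ne_of_overlapCond hq0 hq1 hx hy h)
      (AWOverlap.isContour_of_overlapCond hq0 hq1 h)
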